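/- Let $c\ge 1$, $\sigma\in\mathbb R$, $C,\kappa>0$, $\mu\in\mathbb R$, and for every $n$ let $V_n\in C^2(\mathbb R^n)$. Let $X^{(n)}$ be a random vector in $\mathbb R^n$ with law $\frac1{Z_n}e^{-V_n(x)}dx$, and assume that $\mathrm{Hess}\,V_n\ge \frac1C I_n$, that $X^{(n)}$ has mean zero, identity covariance matrix and $\mathbb E[(X^{(n)}_i)^4]=\mu$ for all $i\le n$, that its law is invariant under permutations of the coordinates, and that $n^{-1}\mathrm{Var}\big(\sum_{i\le n}(X^{(n)}_i)^2\big)\to\kappa$ as $n\to\infty$. Let $m=m(n)$ satisfy $m/n\to c$ and $cn-m\to\sigma$. Let $Y_{n,m}$ be the $n\times m$ matrix whose columns are $m$ independent copies of $\frac1{\sqrt n}X^{(n)}$, let $$W_{n,m}=\begin{pmatrix}0&Y_{n,m}^*\\ Y_{n,m}&0\end{pmatrix},\qquad S=S(z)=(W_{n,m}-z)^{-1}\quad(z\in\mathbb C\setminus\mathbb R),$$ and let $$s^1(z)=-\frac1{2z}\Big(z^2-c+1-\sqrt{(z^2-c+1)^2-4z^2}\Big),\qquad s^2(z)=-\frac1{2cz}\Big(z^2+c-1-\sqrt{(z^2+c-1)^2-4cz^2}\Big),$$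 where the two radicands coincide and the square root is the branch, analytic on $\mathbb C\setminus\mathbb R$, that is equivalent to $z^2$ at infinity. For $R,v_0>0$ put $\mathbb C_{v_0}=\{z\in\mathbb C: |\Im z|\ge v_0,\ |z|<R\}$. Then for every $R>0$ there is a constant $K$ such that for all $n\ge1$, all $v_0\ge n^{-1/16}$ and all $z\in\mathbb C_{v_0}$, $$\max_{1\le i\le m}\mathbb E\big[|S_{ii}(z)-s^2(z)|^2\big]\le K\,\frac{v_0^{-16}}n\qquad\text{and}\qquad \max_{m<i\le n+m}\mathbb E\big[|S_{ii}(z)-s^1(z)|^2\big]\le K\,\frac{v_0^{-16}}n .$$ -/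

import Mathlib

open MeasureTheory ProbabilityTheory Filter Topology

noncomputable section

namespace LogConcaveCov

/-- The law `Z⁻¹ exp (-V x) dx` on `ℝⁿ`, with `Z = ∫ exp (-V x) dx`. -/
def gibbs {n : ℕ} (V : EuclideanSpace ℝ (Fin n) → ℝ) : Measure (EuclideanSpace ℝ (Fin n)) :=
  volume.withDensity fun x => ENNReal.ofReal (Real.exp (-V x) / ∫ y, Real.exp (-V y))

/-- First hypothesis on the potential, in dimension `n`: the Hessian of `V` is bounded below by
`1 / C`, and a random vector `X` with law `gibbs V` is centred, has identity covariance,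
has all fourth moments equal to `μ`, and is exchangeable.
(The Hessian bound makes `gibbs V` a probability measure with finite moments of all orders,
so the integrals below are genuine.) -/
structure Hypo1 {n : ℕ} (V : EuclideanSpace ℝ (Fin n) → ℝ) (C μ : ℝ) : Prop where
  contDiff : ContDiff ℝ 2 V
  hess : ∀ x ξ : EuclideanSpace ℝ (Fin n),
    1 / C * ‖ξ‖ ^ 2 ≤ iteratedFDeriv ℝ 2 V x ![ξ, ξ]
  mean : ∀ i, ∫ x, x i ∂(gibbs V) = 0
  covariance : ∀ i j, ∫ x, x i * x j ∂(gibbs V) = if i = j then 1 else 0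
  fourth : ∀ i, ∫ x, x i ^ 4 ∂(gibbs V) = μ
  exchangeable : ∀ σ : Equiv.Perm (Fin n),
    (gibbs V).map (fun x => WithLp.toLp 2 (fun i => x (σ i))) = gibbs V

/-- The `n × m` matrix whose columns are `X_j / √n`. -/
def Ymat {n m : ℕ} (X : Fin m → EuclideanSpace ℝ (Fin n)) : Matrix (Fin n) (Fin m) ℝ :=
  Matrix.of fun i j => X j i / Real.sqrt n

/-- The symmetric block matrix `W = [[0, Yᵀ], [Y, 0]]` of size `m + n`; the indices `i ≤ m` are
`Sum.inl i`, the indices `i > m` are `Sum.inr i`. -/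
def Wmat {n m : ℕ} (X : Fin m → EuclideanSpace ℝ (Fin n)) :
    Matrix (Fin m ⊕ Fin n) (Fin m ⊕ Fin n) ℝ :=
  Matrix.fromBlocks 0 (Ymat X).transpose (Ymat X) 0

/-- The resolvent `S = (W - z)⁻¹`. -/
def resolvent {n m : ℕ} (X : Fin m → EuclideanSpace ℝ (Fin n)) (z : ℂ) :
    Matrix (Fin m ⊕ Fin n) (Fin m ⊕ Fin n) ℂ :=
  ((Wmat X).map (fun t : ℝ => (t : ℂ)) - z • (1 : Matrix (Fin m ⊕ Fin n) (Fin m ⊕ Fin n) ℂ))⁻¹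

/-- The domain `ℂ_{v₀} = {z = u + iv : |v| ≥ v₀, |z| < R}`. -/
def domain (R v₀ : ℝ) : Set ℂ := {z | v₀ ≤ |z.im| ∧ ‖z‖ < R}

/-- The square root `√((z² - c + 1)² - 4 z²)` in its branch on `ℂ \ ℝ` that is equivalent to `z²` at
infinity: it is `z √(w - 2) √(w + 2)` with `w = (z² - c + 1) / z` and principal roots. See
`sqrtDisc_sq`, `sqrtDisc_sq'` and `s1_im_mul_im_pos` below. -/
def sqrtDisc (c : ℝ) (z : ℂ) : ℂ :=
  z * (((z ^ 2 - c + 1) / z - 2) ^ (1 / 2 : ℂ) * ((z ^ 2 - c + 1) / z + 2) ^ (1 / 2 : ℂ))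

/-- `s¹(z) = -(z² - c + 1 - √((z² - c + 1)² - 4 z²)) / (2 z)`. -/
def s1 (c : ℝ) (z : ℂ) : ℂ := -(1 / (2 * z)) * (z ^ 2 - c + 1 - sqrtDisc c z)

/-- `s²(z) = -(z² + c - 1 - √((z² + c - 1)² - 4 c z²)) / (2 c z)`; the radicand is the same as
in `s¹`. -/
def s2 (c : ℝ) (z : ℂ) : ℂ := -(1 / (2 * c * z)) * (z ^ 2 + c - 1 - sqrtDisc c z)

theorem sqrtDisc_sq (c : ℝ) {z : ℂ} (hz : z ≠ 0) :
    sqrtDisc c z ^ 2 = (z ^ 2 - c + 1) ^ 2 - 4 * z ^ 2 := by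
  have h : ∀ a : ℂ, (a ^ (1 / 2 : ℂ)) ^ 2 = a := fun a => by
    rw [one_div]; exact Complex.cpow_nat_inv_pow a two_ne_zero
  unfold sqrtDisc
  rw [mul_pow, mul_pow, h, h]
  field_simp
  ring

theorem sqrtDisc_sq' (c : ℝ) {z : ℂ} (hz : z ≠ 0) :
    sqrtDisc c z ^ 2 = (z ^ 2 + c - 1) ^ 2 - 4 * c * z ^ 2 := by
  rw [sqrtDisc_sq c hz]; ring

theorem re_im_sqrt (a : ℂ) : 0 ≤ (a ^ (1 / 2 : ℂ)).re ∧
    2 * (a ^ (1 / 2 : ℂ)).re * (a ^ (1 / 2 : ℂ)).im = a.im := by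
  constructor
  · rw [one_div, Complex.cpow_inv_two_re]
    exact Real.sqrt_nonneg _
  · have h : (a ^ (1 / 2 : ℂ)) ^ 2 = a := by
      rw [one_div]; exact Complex.cpow_nat_inv_pow a two_ne_zero
    have h' := congrArg Complex.im h
    rw [pow_two, Complex.mul_im] at h'
    linarith

/-- The branch of the square root is the one for which `s¹` maps the upper half plane to itself and
the lower half plane to itself, as a Stieltjes transform does. -/
theorem s1_im_mul_im_pos {c : ℝ} (hc : 1 ≤ c) {z : ℂ} (hz : z.im ≠ 0) :
    0 < (s1 c z).im * z.im := by
  have hz0 : z ≠ 0 := fun h => hz (by simp [h])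
  obtain ⟨w, hw⟩ : ∃ w : ℂ, w = (z ^ 2 - c + 1) / z := ⟨_, rfl⟩
  have hwim : w.im = z.im * (1 + (c - 1) / Complex.normSq z) := by
    have : w = z - ((c - 1 : ℝ) : ℂ) * z⁻¹ := by
      rw [hw]; push_cast; field_simp; ring
    rw [this, Complex.sub_im, Complex.im_ofReal_mul, Complex.inv_im]
    ring
  have hk : 0 < 1 + (c - 1) / Complex.normSq z := by
    have : 0 ≤ (c - 1) / Complex.normSq z :=
      div_nonneg (by linarith) (Complex.normSq_nonneg z)
    linarith
  obtain ⟨p, hp⟩ : ∃ p : ℂ, p = (w - 2) ^ (1 / 2 : ℂ) := ⟨_, rfl⟩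
  obtain ⟨q, hq⟩ : ∃ q : ℂ, q = (w + 2) ^ (1 / 2 : ℂ) := ⟨_, rfl⟩
  have hp2 : p ^ 2 = w - 2 := by
    rw [hp, one_div]; exact Complex.cpow_nat_inv_pow _ two_ne_zero
  have hq2 : q ^ 2 = w + 2 := by
    rw [hq, one_div]; exact Complex.cpow_nat_inv_pow _ two_ne_zero
  have hs : s1 c z = -(q - p) ^ 2 / 4 := by
    have hwz : z ^ 2 - c + 1 = w * z := by rw [hw]; field_simp
    have h1 : s1 c z = -(w - p * q) / 2 := by
      unfold s1 sqrtDisc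
      rw [← hw, ← hp, ← hq, hwz]
      field_simp
    rw [h1]
    linear_combination (1 / 4 : ℂ) * hp2 + (1 / 4 : ℂ) * hq2
  obtain ⟨hpr, hpi⟩ := re_im_sqrt (w - 2)
  obtain ⟨hqr, hqi⟩ := re_im_sqrt (w + 2)
  rw [← hp] at hpr hpi
  rw [← hq] at hqr hqi
  have hpi' : 2 * p.re * p.im = w.im := by simpa using hpi
  have hqi' : 2 * q.re * q.im = w.im := by simpa using hqi
  have hwz : 0 < w.im * z.im := by
    rw [hwim]
    nlinarith [mul_pos (sq_pos_of_ne_zero hz) hk]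
  have hpr' : 0 < p.re := by
    rcases hpr.lt_or_eq with h | h
    · exact h
    · rw [← h] at hpi'
      have : w.im = 0 := by linarith
      rw [this] at hwz; simp at hwz
  have hqr' : 0 < q.re := by
    rcases hqr.lt_or_eq with h | h
    · exact h
    · rw [← h] at hqi'
      have : w.im = 0 := by linarith
      rw [this] at hwz; simp at hwz
  have hpz : 0 < p.im * z.im := by
    have : 0 < p.re * (p.im * z.im) := by
      rw [← hpi'] at hwz; linarith
    exact (mul_pos_iff_of_pos_left hpr').1 this
  have hqz : 0 < q.im * z.im := by
    have : 0 < q.re * (q.im * z.im) := by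
      rw [← hqi'] at hwz; linarith
    exact (mul_pos_iff_of_pos_left hqr').1 this
  have hmul : (q - p) * (q + p) = 4 := by linear_combination hq2 - hp2
  have hne : q + p ≠ 0 := by
    intro h; rw [h] at hmul; norm_num at hmul
  have hd : q - p = 4 * (q + p)⁻¹ := by
    field_simp; exact hmul
  have him : (q - p).im = -(4 * (q + p).im / Complex.normSq (q + p)) := by
    rw [hd, Complex.mul_im, Complex.inv_im]; simp; ring
  have hre : (q - p).re = 4 * (q + p).re / Complex.normSq (q + p) := by
    rw [hd, Complex.mul_re, Complex.inv_re]; simp; ring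
  have hN : 0 < Complex.normSq (q + p) := Complex.normSq_pos.2 hne
  have hfin : (s1 c z).im * z.im
      = 8 * (q.re + p.re) * (q.im * z.im + p.im * z.im) / Complex.normSq (q + p) ^ 2 := by
    have : (s1 c z).im = -((q - p).re * (q - p).im) / 2 := by
      rw [hs]
      have : -(q - p) ^ 2 / 4 = ((-1 / 4 : ℝ) : ℂ) * ((q - p) * (q - p)) := by
        push_cast; ring
      rw [this, Complex.im_ofReal_mul, Complex.mul_im]
      ring
    rw [this, him, hre, Complex.add_re, Complex.add_im]
    field_simp
    ring
  rw [hfin]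
  positivity

end LogConcaveCov

end

/-!
The proof rests on exchangeability rather than on concentration inequalities for log-concave
measures; the Hessian bound is used only to dominate the density by a Gaussian one.

The fourth moments of an exchangeable vector form a symmetric tensor invariant under permutations
of the basis, hence a combination of products of Kronecker symbols with five coefficients
(`eq_invTensor`). Isotropy, `Var |x|² = O(n)` and `(∑ xᵢ)² ≤ n |x|²` show that these coefficients
are Gaussian up to `O(1/n)`, apart from the two terms supported on coincidences of at least three
indices, which stay bounded (`exists_moment_bounds`). Consequently `xᵀ B x` has variance
`O(n ‖B‖²)`, and the fourth moment of `∑ uᵢ xᵢ` is `O(|u|² (|u|² + (∑ uᵢ)²))`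
(`exists_form_bounds`).

Write `v = Im z`, let `N` be the lower block of the resolvent of the model with the `k`-th column
`y` removed, and let `g` be the normalized trace of the lower block of `S`. The Schur complement
formula `S_kk (z + yᵀ N y) = -1` (`resolvent_inl_mul`) and the Ward identity show that `yᵀ N y` is
within `O(n^(-1/2) / |v|)` of `g` in mean square. Summing over `k` gives `g` the quadratic equation
of `s¹` up to an error. Its roots are `s¹` and `1 / s¹`, and the second one is at distance at least
`|v|` from `g`, since it lies in the opposite half-plane; so `g - s¹` is controlled by the error
(`norm_ntr_sub_s1_le`), and the Schur complement formula transfers this to `S_kk - s²`.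

For an index `i` in the other block, exchangeability gives `S_ii` the mean of `g`. Its fluctuations
are bounded by the Efron–Stein inequality (`efron_stein`) over the independent columns: the removal
of the `k`-th column changes `S_ii` by `S_kk (N y)_i²`, whose second moment is `O(n^(-2))` by the
bound on linear forms.
-/

noncomputable section

namespace LogConcaveCov

/-! ### Strongly log-concave laws -/

/-- Second-order Taylor lower bound on the line, from a lower bound on the second derivative. -/
theorem add_deriv_add_half_le_of_le_deriv2 {φ φ' φ'' : ℝ → ℝ} {k : ℝ}
    (h1 : ∀ t, HasDerivAt φ (φ' t) t) (h2 : ∀ t, HasDerivAt φ' (φ'' t) t)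
    (hk : ∀ t, k ≤ φ'' t) : φ 0 + φ' 0 + k / 2 ≤ φ 1 := by
  have hd : ∀ t, HasDerivAt (fun t => φ t - k / 2 * t ^ 2) (φ' t - k * t) t := fun t => by
    convert! (h1 t).sub (((hasDerivAt_id t).pow 2).const_mul (k / 2)) using 1
    simp; ring
  have hd2 : ∀ t, HasDerivAt (fun t => φ' t - k * t) (φ'' t - k) t := fun t => by
    convert! (h2 t).sub ((hasDerivAt_id t).const_mul k) using 1
    simp
  have e1 : deriv (fun t => φ t - k / 2 * t ^ 2) = fun t => φ' t - k * t :=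
    funext fun t => (hd t).deriv
  have hconv : ConvexOn ℝ Set.univ (fun t => φ t - k / 2 * t ^ 2) := by
    refine convexOn_univ_of_deriv2_nonneg (fun t => (hd t).differentiableAt) ?_ fun t => ?_
    · rw [e1]; exact fun t => (hd2 t).differentiableAt
    · rw [Function.iterate_succ, Function.iterate_one, Function.comp_apply, e1, (hd2 t).deriv]
      linarith [hk t]
  have := hconv.le_slope_of_hasDerivAt (Set.mem_univ 0) (Set.mem_univ 1) one_pos (hd 0)
  rw [slope_def_field] at this
  norm_num at this
  linarith

/-- A Hessian bound `k` puts the potential above its tangent paraboloid of curvature `k` at `0`. -/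
theorem quadratic_lower_bound {E : Type*} [NormedAddCommGroup E] [NormedSpace ℝ E]
    {V : E → ℝ} {k : ℝ} (hV : ContDiff ℝ 2 V)
    (h : ∀ x ξ : E, k * ‖ξ‖ ^ 2 ≤ iteratedFDeriv ℝ 2 V x ![ξ, ξ]) (x : E) :
    V 0 + fderiv ℝ V 0 x + k / 2 * ‖x‖ ^ 2 ≤ V x := by
  have hV1 : Differentiable ℝ V := hV.differentiable (by norm_num)
  have hV2 : Differentiable ℝ (fderiv ℝ V) :=
    (hV.fderiv_right (m := 1) (by norm_num)).differentiable (by norm_num)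
  have hl : ∀ t : ℝ, HasDerivAt (fun t : ℝ => t • x) x t := fun t => by
    simpa using (hasDerivAt_id t).smul_const x
  have := add_deriv_add_half_le_of_le_deriv2 (φ := fun t => V (t • x))
    (φ' := fun t => fderiv ℝ V (t • x) x)
    (φ'' := fun t => fderiv ℝ (fderiv ℝ V) (t • x) x x) (k := k * ‖x‖ ^ 2)
    (fun t => (hV1 _).hasFDerivAt.comp_hasDerivAt t (hl t))
    (fun t => by
      have h0 := (hV2 (t • x)).hasFDerivAt.comp_hasDerivAt t (hl t)
      exact (ContinuousLinearMap.apply ℝ ℝ x).hasFDerivAt.comp_hasDerivAt t h0)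
    (fun t => by
      have := h (t • x) x
      rw [iteratedFDeriv_two_apply] at this
      simpa using this)
  simp only [zero_smul, one_smul] at this
  linarith

section

variable {n : ℕ} {V : EuclideanSpace ℝ (Fin n) → ℝ} {C μ : ℝ}

/-- The density times a polynomial weight is dominated by a Gaussian density. -/
theorem Hypo1.integrable_norm_pow_four_mul_exp (h : Hypo1 V C μ) (hC : 0 < C) :
    Integrable (fun x => (1 + ‖x‖ ^ 4) * Real.exp (-V x)) := by
  set w := (InnerProductSpace.toDual ℝ (EuclideanSpace ℝ (Fin n))).symm (fderiv ℝ V 0) with hw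
  have hL : ∀ x, fderiv ℝ V 0 x = inner ℝ w x := fun x => by
    rw [hw, InnerProductSpace.toDual_symm_apply]
  have hk : 0 < 1 / C := by positivity
  set k := 1 / C with hkdef
  have hg : Integrable (fun x : EuclideanSpace ℝ (Fin n) =>
      (1 + 32 / k ^ 2) * (Real.exp (-V 0) * Real.exp (-(k / 4) * ‖x‖ ^ 2 + (-1) * inner ℝ w x))) := by
    have := (GaussianFourier.integrable_cexp_neg_mul_sq_norm_add (V := EuclideanSpace ℝ (Fin n))
      (b := ((k / 4 : ℝ) : ℂ)) (by rw [Complex.ofReal_re]; positivity) (-1) w).re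
    refine ((this.congr (ae_of_all _ fun x => ?_)).const_mul _).const_mul _
    have e : (-((k / 4 : ℝ) : ℂ) * (‖x‖ : ℂ) ^ 2 + -1 * ((inner ℝ w x : ℝ) : ℂ)) =
      ((-(k / 4) * ‖x‖ ^ 2 + (-1) * inner ℝ w x : ℝ) : ℂ) := by push_cast; ring
    simp only [e, RCLike.re_to_complex]
    exact Complex.exp_ofReal_re _
  refine hg.mono' ?_ (ae_of_all _ fun x => ?_)
  · have := h.contDiff.continuous
    exact (by fun_prop : Continuous _).aestronglyMeasurable
  have hb := quadratic_lower_bound h.contDiff h.hess x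
  rw [hL] at hb
  have ht : 0 ≤ k / 4 * ‖x‖ ^ 2 := by positivity
  have h1 : ‖x‖ ^ 4 ≤ 32 / k ^ 2 * Real.exp (k / 4 * ‖x‖ ^ 2) := by
    have := Real.pow_div_factorial_le_exp _ ht 2
    norm_num at this
    calc ‖x‖ ^ 4 = 32 / k ^ 2 * ((k / 4 * ‖x‖ ^ 2) ^ 2 / 2) := by field_simp; ring
      _ ≤ _ := by gcongr
  have h2 : 1 + ‖x‖ ^ 4 ≤ (1 + 32 / k ^ 2) * Real.exp (k / 4 * ‖x‖ ^ 2) := by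
    linarith [Real.one_le_exp ht]
  rw [Real.norm_of_nonneg (by positivity)]
  calc (1 + ‖x‖ ^ 4) * Real.exp (-V x)
      ≤ ((1 + 32 / k ^ 2) * Real.exp (k / 4 * ‖x‖ ^ 2)) *
        Real.exp (-V 0 - inner ℝ w x - k / 2 * ‖x‖ ^ 2) := by
        gcongr; linarith
    _ = _ := by
        rw [mul_assoc, ← Real.exp_add, ← Real.exp_add]; congr 2; ring

theorem Hypo1.integrable_exp (h : Hypo1 V C μ) (hC : 0 < C) :
    Integrable (fun x => Real.exp (-V x)) := by
  refine (h.integrable_norm_pow_four_mul_exp hC).mono' ?_ (ae_of_all _ fun x => ?_)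
  · have := h.contDiff.continuous
    exact (by fun_prop : Continuous _).aestronglyMeasurable
  rw [Real.norm_of_nonneg (by positivity)]
  exact le_mul_of_one_le_left (by positivity) (by linarith [pow_nonneg (norm_nonneg x) 4])

theorem Hypo1.isProbabilityMeasure (h : Hypo1 V C μ) (hC : 0 < C) :
    IsProbabilityMeasure (gibbs V) := by
  have hi := h.integrable_exp hC
  have hZ := integral_exp_pos hi
  constructor
  rw [gibbs, withDensity_apply _ MeasurableSet.univ, Measure.restrict_univ,
    ← ofReal_integral_eq_lintegral_ofReal (hi.div_const _) (ae_of_all _ fun x => by positivity),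
    integral_div, div_self hZ.ne', ENNReal.ofReal_one]

theorem Hypo1.integrable_norm_pow_four (h : Hypo1 V C μ) (hC : 0 < C) :
    Integrable (fun x => ‖x‖ ^ 4) (gibbs V) := by
  have hc := h.contDiff.continuous
  have hZ := integral_exp_pos (h.integrable_exp hC)
  rw [gibbs, integrable_withDensity_iff_integrable_smul' (by fun_prop) (by simp)]
  refine ((h.integrable_norm_pow_four_mul_exp hC).div_const (∫ y, Real.exp (-V y))).mono' ?_
    (ae_of_all _ fun x => ?_)
  · exact (by fun_prop : Measurable _).aestronglyMeasurable
  rw [ENNReal.toReal_ofReal (by positivity), smul_eq_mul, Real.norm_of_nonneg (by positivity),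
    div_mul_eq_mul_div, mul_comm]
  gcongr
  linarith

end

/-! ### Fourth moments of an exchangeable vector -/

/-- What is used of the law of the columns: it is an exchangeable probability measure with finite
fourth moments, identity second moments, fourth moment `μ` in each coordinate, and
`Var |x|² ≤ K₀ n`. -/
structure IsotropicExch {n : ℕ} (γ : Measure (EuclideanSpace ℝ (Fin n))) (μ K₀ : ℝ) : Prop where
  prob : IsProbabilityMeasure γ
  integrable : Integrable (fun x => ‖x‖ ^ 4) γ
  covariance : ∀ i j, ∫ x, x i * x j ∂γ = if i = j then 1 else 0
  fourth : ∀ i, ∫ x, x i ^ 4 ∂γ = μ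
  exchangeable : ∀ σ : Equiv.Perm (Fin n),
    γ.map (fun x => WithLp.toLp 2 (fun i => x (σ i))) = γ
  variance_le : variance (fun x : EuclideanSpace ℝ (Fin n) => ∑ i, x i ^ 2) γ ≤ K₀ * n

/-- Any two injective families of the same length are matched by a permutation. -/
theorem exists_perm_extending {n r : ℕ} {p q : Fin r → Fin n} (hp : p.Injective)
    (hq : q.Injective) : ∃ τ : Equiv.Perm (Fin n), ∀ s, τ (p s) = q s := by
  classical
  let e : {x // x ∈ Set.range p} ≃ {x // x ∈ Set.range q} :=
    (Equiv.ofInjective p hp).symm.trans (Equiv.ofInjective q hq)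
  refine ⟨e.extendSubtype, fun s => ?_⟩
  rw [Equiv.extendSubtype_apply_of_mem e (p s) ⟨s, rfl⟩]
  simp only [e, Equiv.trans_apply]
  rw [Equiv.ofInjective_symm_apply hp s, Equiv.ofInjective_apply]

/-- The indicator of `i = j`, as a real number. -/
def kron {ι : Type*} [DecidableEq ι] (i j : ι) : ℝ := if i = j then 1 else 0

@[simp] theorem kron_self {ι : Type*} [DecidableEq ι] (i : ι) : kron i i = 1 := by simp [kron]

theorem kron_ne {ι : Type*} [DecidableEq ι] {i j : ι} (h : i ≠ j) : kron i j = 0 := by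
  simp [kron, h]

/-- The general symmetric 4-tensor on `ℝ^ι` invariant under permutations of the basis: one
coefficient for each shape of a partition of the four positions. -/
def invTensor {ι : Type*} [DecidableEq ι] (f e d b a : ℝ) (i j k l : ι) : ℝ :=
  f + e * (kron i j + kron i k + kron i l + kron j k + kron j l + kron k l)
    + d * (kron i j * kron k l + kron i k * kron j l + kron i l * kron j k)
    + b * (kron i j * kron j k + kron i j * kron j l + kron i k * kron k l + kron j k * kron k l)
    + a * (kron i j * kron j k * kron k l)

/-- A symmetric 4-tensor invariant under permutations of the basis is an `invTensor`; its
coefficients come from the values `a, b, d, e, f` on the five coincidence patterns of indices by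
inclusion–exclusion over partitions. -/
theorem eq_invTensor {n : ℕ} (T : Fin n → Fin n → Fin n → Fin n → ℝ) (hn : 4 ≤ n)
    (h12 : ∀ i j k l, T i j k l = T j i k l) (h23 : ∀ i j k l, T i j k l = T i k j l)
    (h34 : ∀ i j k l, T i j k l = T i j l k)
    (hT : ∀ (τ : Equiv.Perm (Fin n)) i j k l, T (τ i) (τ j) (τ k) (τ l) = T i j k l) :
    ∃ i₁ i₂ i₃ i₄ : Fin n, i₁ ≠ i₂ ∧ i₁ ≠ i₃ ∧ i₁ ≠ i₄ ∧ i₂ ≠ i₃ ∧ i₂ ≠ i₄ ∧ i₃ ≠ i₄ ∧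
    ∃ a b d e f, a = T i₁ i₁ i₁ i₁ ∧ b = T i₁ i₁ i₁ i₂ ∧ d = T i₁ i₁ i₂ i₂ ∧
      e = T i₁ i₁ i₂ i₃ ∧ f = T i₁ i₂ i₃ i₄ ∧ ∀ i j k l, T i j k l =
      invTensor f (e - f) (d - 2 * e + f) (b - 3 * e + 2 * f)
        (a - 4 * b - 3 * d + 12 * e - 6 * f) i j k l := by
  set p : Fin 4 → Fin n := Fin.castLE hn with hp
  have pinj : p.Injective := Fin.castLE_injective hn
  have hne : ∀ s t : Fin 4, s ≠ t → p s ≠ p t := fun s t h => pinj.ne h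
  refine ⟨p 0, p 1, p 2, p 3, hne _ _ (by decide), hne _ _ (by decide), hne _ _ (by decide),
    hne _ _ (by decide), hne _ _ (by decide), hne _ _ (by decide), _, _, _, _, _, rfl, rfl, rfl,
    rfl, rfl, ?_⟩
  set a := T (p 0) (p 0) (p 0) (p 0) with ha0
  set b := T (p 0) (p 0) (p 0) (p 1) with hb0
  set d := T (p 0) (p 0) (p 1) (p 1) with hd0
  set e := T (p 0) (p 0) (p 1) (p 2) with he0
  set f := T (p 0) (p 1) (p 2) (p 3) with hf0
  have ha : ∀ i, T i i i i = a := fun i => by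
    obtain ⟨τ, h⟩ := exists_perm_extending (p := ![p 0]) (q := ![i])
      (Function.injective_of_subsingleton _) (Function.injective_of_subsingleton _)
    have h0 := h 0
    simp only [Matrix.cons_val_zero] at h0
    rw [ha0, ← h0, hT]
  have inj2 : ∀ {i j : Fin n}, i ≠ j → (![i, j]).Injective := fun {i j} h s t => by
    fin_cases s <;> fin_cases t <;> simp [h, h.symm]
  have inj3 : ∀ {i j k : Fin n}, i ≠ j → i ≠ k → j ≠ k → (![i, j, k]).Injective :=
    fun {i j k} h1 h2 h3 s t => by
      fin_cases s <;> fin_cases t <;> simp [h1, h1.symm, h2, h2.symm, h3, h3.symm]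
  have inj4 : ∀ {i j k l : Fin n}, i ≠ j → i ≠ k → i ≠ l → j ≠ k → j ≠ l → k ≠ l →
      (![i, j, k, l]).Injective := fun {i j k l} h1 h2 h3 h4 h5 h6 s t => by
    fin_cases s <;> fin_cases t <;>
      simp [h1, h1.symm, h2, h2.symm, h3, h3.symm, h4, h4.symm, h5, h5.symm, h6, h6.symm]
  have hb : ∀ i j, i ≠ j → T i i i j = b := fun i j hij => by
    obtain ⟨τ, h⟩ := exists_perm_extending (inj2 (hne 0 1 (by decide))) (inj2 hij)
    have h0 := h 0
    have h1 := h 1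
    simp only [Matrix.cons_val_zero, Matrix.cons_val_one] at h0 h1
    rw [hb0, ← h0, ← h1, hT]
  have hd : ∀ i j, i ≠ j → T i i j j = d := fun i j hij => by
    obtain ⟨τ, h⟩ := exists_perm_extending (inj2 (hne 0 1 (by decide))) (inj2 hij)
    have h0 := h 0
    have h1 := h 1
    simp only [Matrix.cons_val_zero, Matrix.cons_val_one] at h0 h1
    rw [hd0, ← h0, ← h1, hT]
  have he : ∀ i j k, i ≠ j → i ≠ k → j ≠ k → T i i j k = e := fun i j k h1 h2 h3 => by
    obtain ⟨τ, h⟩ := exists_perm_extending (inj3 (hne 0 1 (by decide)) (hne 0 2 (by decide))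
      (hne 1 2 (by decide))) (inj3 h1 h2 h3)
    have h0 := h 0
    have h1 := h 1
    have h2 := h 2
    simp only [Matrix.cons_val_zero, Matrix.cons_val_one, Matrix.cons_val] at h0 h1 h2
    rw [he0, ← h0, ← h1, ← h2, hT]
  have hf : ∀ i j k l, i ≠ j → i ≠ k → i ≠ l → j ≠ k → j ≠ l → k ≠ l → T i j k l = f :=
    fun i j k l h1 h2 h3 h4 h5 h6 => by
    obtain ⟨τ, h⟩ := exists_perm_extending (inj4 (hne 0 1 (by decide)) (hne 0 2 (by decide))
      (hne 0 3 (by decide)) (hne 1 2 (by decide)) (hne 1 3 (by decide)) (hne 2 3 (by decide)))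
      (inj4 h1 h2 h3 h4 h5 h6)
    have h0 := h 0
    have h1 := h 1
    have h2 := h 2
    have h3 := h 3
    simp only [Matrix.cons_val_zero, Matrix.cons_val_one, Matrix.cons_val] at h0 h1 h2 h3
    rw [hf0, ← h0, ← h1, ← h2, ← h3, hT]
  have hb2 : ∀ i j, i ≠ j → T i i j i = b := fun i j h => by rw [h34, hb i j h]
  have hb3 : ∀ i j, i ≠ j → T i j i i = b := fun i j h => by rw [h23, hb2 i j h]
  have hb4 : ∀ i j, i ≠ j → T j i i i = b := fun i j h => by rw [h12, hb3 i j h]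
  have hd2 : ∀ i j, i ≠ j → T i j i j = d := fun i j h => by rw [h23, hd i j h]
  have hd3 : ∀ i j, i ≠ j → T i j j i = d := fun i j h => by rw [h34, hd2 i j h]
  have he2 : ∀ i j k, i ≠ j → i ≠ k → j ≠ k → T i j i k = e := fun i j k h1 h2 h3 => by
    rw [h23, he i j k h1 h2 h3]
  have he3 : ∀ i j k, i ≠ j → i ≠ k → j ≠ k → T i j k i = e := fun i j k h1 h2 h3 => by
    rw [h34, he2 i j k h1 h2 h3]
  have he4 : ∀ i j k, i ≠ j → i ≠ k → j ≠ k → T j i i k = e := fun i j k h1 h2 h3 => by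
    rw [h12, he2 i j k h1 h2 h3]
  have he5 : ∀ i j k, i ≠ j → i ≠ k → j ≠ k → T j i k i = e := fun i j k h1 h2 h3 => by
    rw [h12, he3 i j k h1 h2 h3]
  have he6 : ∀ i j k, i ≠ j → i ≠ k → j ≠ k → T j k i i = e := fun i j k h1 h2 h3 => by
    rw [h23, he5 i j k h1 h2 h3]
  intro i j k l
  unfold invTensor
  -- one case for each of the fifteen partitions of the four positions
  rcases eq_or_ne i j with rfl | hij
  · rcases eq_or_ne i k with rfl | hik
    · rcases eq_or_ne i l with rfl | hil
      · rw [ha]; simp only [kron_self]; ring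
      · rw [hb _ _ hil]; simp only [kron_self, kron_ne hil]; ring
    · rcases eq_or_ne i l with rfl | hil
      · rw [hb2 _ _ hik]; simp only [kron_self, kron_ne hik, kron_ne hik.symm]; ring
      · rcases eq_or_ne k l with rfl | hkl
        · rw [hd _ _ hik]; simp only [kron_self, kron_ne hik]; ring
        · rw [he _ _ _ hik hil hkl]
          simp only [kron_self, kron_ne hik, kron_ne hil, kron_ne hkl]; ring
  · rcases eq_or_ne i k with rfl | hik
    · rcases eq_or_ne i l with rfl | hil
      · rw [hb3 _ _ hij]; simp only [kron_self, kron_ne hij, kron_ne hij.symm]; ring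
      · rcases eq_or_ne j l with rfl | hjl
        · rw [hd2 _ _ hij]; simp only [kron_self, kron_ne hij, kron_ne hij.symm]; ring
        · rw [he2 _ _ _ hij hil hjl]
          simp only [kron_self, kron_ne hij, kron_ne hij.symm, kron_ne hil, kron_ne hjl]; ring
    · rcases eq_or_ne i l with rfl | hil
      · rcases eq_or_ne j k with rfl | hjk
        · rw [hd3 _ _ hij]; simp only [kron_self, kron_ne hij, kron_ne hij.symm]; ring
        · rw [he3 _ _ _ hij hik hjk]
          simp only [kron_self, kron_ne hij, kron_ne hij.symm, kron_ne hik, kron_ne hik.symm,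
            kron_ne hjk]
          ring
      · rcases eq_or_ne j k with rfl | hjk
        · rcases eq_or_ne j l with rfl | hjl
          · rw [hb4 _ _ hij.symm]; simp only [kron_self, kron_ne hij]; ring
          · rw [he4 _ _ _ hij.symm hjl hil]
            simp only [kron_self, kron_ne hij, kron_ne hil, kron_ne hjl]; ring
        · rcases eq_or_ne j l with rfl | hjl
          · rw [he5 _ _ _ hij.symm hjk hik]
            simp only [kron_self, kron_ne hij, kron_ne hik, kron_ne hjk, kron_ne hjk.symm]; ring
          · rcases eq_or_ne k l with rfl | hkl
            · rw [he6 _ _ _ hik.symm hjk.symm hij]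
              simp only [kron_self, kron_ne hij, kron_ne hik, kron_ne hjk]; ring
            · rw [hf _ _ _ _ hij hik hil hjk hjl hkl]
              simp only [kron_ne hij, kron_ne hik, kron_ne hil, kron_ne hjk, kron_ne hjl,
                kron_ne hkl]
              ring

set_option linter.unusedSimpArgs false in
/-- Contraction of the invariant 4-tensor with two symmetric matrices. -/
theorem sum_mul_invTensor {ι : Type*} [Fintype ι] [DecidableEq ι] (B G : ι → ι → ℝ)
    (hB : ∀ i j, B i j = B j i) (hG : ∀ i j, G i j = G j i) (f e d b a : ℝ) :
    ∑ i, ∑ j, ∑ k, ∑ l, B i j * G k l * invTensor f e d b a i j k l =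
      f * ((∑ i, ∑ j, B i j) * ∑ i, ∑ j, G i j)
      + e * ((∑ i, B i i) * (∑ i, ∑ j, G i j) + (∑ i, ∑ j, B i j) * (∑ i, G i i)
        + 4 * ∑ i, (∑ j, B i j) * ∑ j, G i j)
      + d * ((∑ i, B i i) * (∑ i, G i i) + 2 * ∑ i, ∑ j, B i j * G i j)
      + b * (2 * ∑ i, B i i * (∑ j, G i j) + 2 * ∑ i, (∑ j, B i j) * G i i)
      + a * ∑ i, B i i * G i i := by
  have hB' : ∀ i, ∑ j, B j i = ∑ j, B i j := fun i => Finset.sum_congr rfl fun j _ => hB j i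
  have hG' : ∀ i, ∑ j, G j i = ∑ j, G i j := fun i => Finset.sum_congr rfl fun j _ => hG j i
  obtain ⟨L, hL⟩ : ∃ L : (ι → ι → ι → ι → ℝ) → ℝ,
      ∀ X, L X = ∑ i, ∑ j, ∑ k, ∑ l, B i j * G k l * X i j k l := ⟨_, fun _ => rfl⟩
  have hadd : ∀ X Y, L (fun i j k l => X i j k l + Y i j k l) = L X + L Y := fun X Y => by
    simp only [hL, mul_add, Finset.sum_add_distrib]
  have hmul : ∀ c X, L (fun i j k l => c * X i j k l) = c * L X := fun c X => by
    simp only [hL, Finset.mul_sum, mul_left_comm c]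
  have s_0 : L (fun _ _ _ _ => f) = f * ((∑ i, ∑ j, B i j) * ∑ i, ∑ j, G i j) := by
    rw [hL]
    simp_rw [mul_comm _ f, ← Finset.mul_sum, ← Finset.sum_mul]
  have s_ij : L (fun i j k l => kron i j) = (∑ i, B i i) * ∑ i, ∑ j, G i j := by
    simp only [hL, kron, mul_ite, mul_one, mul_zero, Finset.sum_ite_irrel, Finset.sum_const_zero,
      Finset.sum_ite_eq, Finset.mem_univ, if_true, ← Finset.mul_sum, ← Finset.sum_mul, hG']
  have s_ik : L (fun i j k l => kron i k) = ∑ i, (∑ j, B i j) * ∑ j, G i j := by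
    simp only [hL, kron, mul_ite, mul_one, mul_zero, Finset.sum_ite_irrel, Finset.sum_const_zero,
      Finset.sum_ite_eq, Finset.mem_univ, if_true, ← Finset.mul_sum, ← Finset.sum_mul, hG']
  have s_il : L (fun i j k l => kron i l) = ∑ i, (∑ j, B i j) * ∑ j, G i j := by
    simp only [hL, kron, mul_ite, mul_one, mul_zero, Finset.sum_ite_irrel, Finset.sum_const_zero,
      Finset.sum_ite_eq, Finset.mem_univ, if_true, ← Finset.mul_sum, ← Finset.sum_mul, hG']
  have s_jk : L (fun i j k l => kron j k) = ∑ i, (∑ j, B i j) * ∑ j, G i j := by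
    simp only [hL, kron, mul_ite, mul_one, mul_zero, Finset.sum_ite_irrel, Finset.sum_const_zero,
      Finset.sum_ite_eq, Finset.mem_univ, if_true, ← Finset.mul_sum, ← Finset.sum_mul, hG']
    rw [Finset.sum_comm]
    simp only [← Finset.sum_mul, hB']
  have s_jl : L (fun i j k l => kron j l) = ∑ i, (∑ j, B i j) * ∑ j, G i j := by
    simp only [hL, kron, mul_ite, mul_one, mul_zero, Finset.sum_ite_irrel, Finset.sum_const_zero,
      Finset.sum_ite_eq, Finset.mem_univ, if_true, ← Finset.mul_sum, ← Finset.sum_mul, hG']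
    rw [Finset.sum_comm]
    simp only [← Finset.sum_mul, hB']
  have s_kl : L (fun i j k l => kron k l) = (∑ i, ∑ j, B i j) * ∑ i, G i i := by
    simp only [hL, kron, mul_ite, mul_one, mul_zero, Finset.sum_ite_irrel, Finset.sum_const_zero,
      Finset.sum_ite_eq, Finset.mem_univ, if_true, ← Finset.mul_sum, ← Finset.sum_mul, hG']
  have s_ijkl : L (fun i j k l => kron i j * kron k l) = (∑ i, B i i) * ∑ i, G i i := by
    simp only [hL, kron, mul_ite, mul_one, mul_zero, Finset.sum_ite_irrel, Finset.sum_const_zero,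
      Finset.sum_ite_eq, Finset.mem_univ, if_true, ← Finset.mul_sum, ← Finset.sum_mul, hG']
  have s_ikjl : L (fun i j k l => kron i k * kron j l) = ∑ i, ∑ j, B i j * G i j := by
    simp only [hL, kron, mul_ite, mul_one, mul_zero, Finset.sum_ite_irrel, Finset.sum_const_zero,
      Finset.sum_ite_eq, Finset.mem_univ, if_true, ← Finset.mul_sum, ← Finset.sum_mul, hG']
  have s_iljk : L (fun i j k l => kron i l * kron j k) = ∑ i, ∑ j, B i j * G i j := by
    simp only [hL, kron, mul_ite, mul_one, mul_zero, Finset.sum_ite_irrel, Finset.sum_const_zero,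
      Finset.sum_ite_eq, Finset.mem_univ, if_true, ← Finset.mul_sum, ← Finset.sum_mul, hG']
    exact Finset.sum_congr rfl fun i _ => Finset.sum_congr rfl fun j _ => by rw [hG]
  have s_ijk : L (fun i j k l => kron i j * kron j k) = ∑ i, B i i * ∑ j, G i j := by
    simp only [hL, kron, mul_ite, mul_one, mul_zero, Finset.sum_ite_irrel, Finset.sum_const_zero,
      Finset.sum_ite_eq, Finset.mem_univ, if_true, ← Finset.mul_sum, ← Finset.sum_mul, hG']
  have s_ijl : L (fun i j k l => kron i j * kron j l) = ∑ i, B i i * ∑ j, G i j := by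
    simp only [hL, kron, mul_ite, mul_one, mul_zero, Finset.sum_ite_irrel, Finset.sum_const_zero,
      Finset.sum_ite_eq, Finset.mem_univ, if_true, ← Finset.mul_sum, ← Finset.sum_mul, hG']
  have s_ikl : L (fun i j k l => kron i k * kron k l) = ∑ i, (∑ j, B i j) * G i i := by
    simp only [hL, kron, mul_ite, mul_one, mul_zero, Finset.sum_ite_irrel, Finset.sum_const_zero,
      Finset.sum_ite_eq, Finset.mem_univ, if_true, ← Finset.mul_sum, ← Finset.sum_mul, hG']
  have s_jkl : L (fun i j k l => kron j k * kron k l) = ∑ i, (∑ j, B i j) * G i i := by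
    simp only [hL, kron, mul_ite, mul_one, mul_zero, Finset.sum_ite_irrel, Finset.sum_const_zero,
      Finset.sum_ite_eq, Finset.mem_univ, if_true, ← Finset.mul_sum, ← Finset.sum_mul, hG']
    rw [Finset.sum_comm]
    simp only [← Finset.sum_mul, hB']
  have s_all : L (fun i j k l => kron i j * kron j k * kron k l) = ∑ i, B i i * G i i := by
    simp only [hL, kron, mul_ite, mul_one, mul_zero, Finset.sum_ite_irrel, Finset.sum_const_zero,
      Finset.sum_ite_eq, Finset.mem_univ, if_true, ← Finset.mul_sum, ← Finset.sum_mul, hG']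
  rw [← hL]
  unfold invTensor
  simp only [hadd, hmul, s_0, s_ij, s_ik, s_il, s_jk, s_jl, s_kl,
    s_ijkl, s_ikjl, s_iljk, s_ijk, s_ijl, s_ikl, s_jkl, s_all]
  ring

/-- The quadratic form `x ↦ xᵀ B x`. -/
def qform {n : ℕ} (B : Fin n → Fin n → ℝ) (x : EuclideanSpace ℝ (Fin n)) : ℝ :=
  ∑ i, ∑ j, B i j * (x i * x j)

theorem continuous_qform {n : ℕ} (B : Fin n → Fin n → ℝ) : Continuous (qform B) := by
  unfold qform; fun_prop

theorem qform_mul_qform {n : ℕ} (B G : Fin n → Fin n → ℝ) (x : EuclideanSpace ℝ (Fin n)) :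
    qform B x * qform G x =
      ∑ i, ∑ j, ∑ k, ∑ l, B i j * G k l * (x i * x j * x k * x l) := by
  unfold qform
  rw [Finset.sum_mul]
  refine Finset.sum_congr rfl fun i _ => ?_
  rw [Finset.sum_mul]
  refine Finset.sum_congr rfl fun j _ => ?_
  rw [Finset.mul_sum]
  refine Finset.sum_congr rfl fun k _ => ?_
  rw [Finset.mul_sum]
  exact Finset.sum_congr rfl fun l _ => by ring

namespace IsotropicExch

variable {n : ℕ} {γ : Measure (EuclideanSpace ℝ (Fin n))} {μ K₀ : ℝ}

theorem integrable_mul_mul_mul (h : IsotropicExch γ μ K₀) (i j k l : Fin n) :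
    Integrable (fun x => x i * x j * x k * x l) γ := by
  refine h.integrable.mono' (by fun_prop : Continuous _).aestronglyMeasurable
    (ae_of_all _ fun x => ?_)
  have := fun i => PiLp.norm_apply_le x i
  simp only [norm_mul]
  calc ‖x i‖ * ‖x j‖ * ‖x k‖ * ‖x l‖ ≤ ‖x‖ * ‖x‖ * ‖x‖ * ‖x‖ := by gcongr <;> apply this
    _ = ‖x‖ ^ 4 := by ring

theorem integrable_mul (h : IsotropicExch γ μ K₀) (i j : Fin n) :
    Integrable (fun x => x i * x j) γ := by
  have := h.prob
  refine ((integrable_const (1 : ℝ)).add h.integrable).mono'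
    (by fun_prop : Continuous _).aestronglyMeasurable (ae_of_all _ fun x => ?_)
  have := fun i => PiLp.norm_apply_le x i
  simp only [norm_mul]
  calc ‖x i‖ * ‖x j‖ ≤ ‖x‖ * ‖x‖ := by gcongr <;> apply this
    _ ≤ 1 + ‖x‖ ^ 4 := by nlinarith [sq_nonneg (‖x‖ ^ 2 - 1)]

theorem integrable_qform (h : IsotropicExch γ μ K₀) (B : Fin n → Fin n → ℝ) :
    Integrable (qform B) γ :=
  integrable_finsetSum _ fun i _ => integrable_finsetSum _ fun j _ =>
    (h.integrable_mul i j).const_mul _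

theorem integrable_qform_mul (h : IsotropicExch γ μ K₀) (B G : Fin n → Fin n → ℝ) :
    Integrable (fun x => qform B x * qform G x) γ := by
  simp_rw [qform_mul_qform]
  exact integrable_finsetSum _ fun i _ => integrable_finsetSum _ fun j _ =>
    integrable_finsetSum _ fun k _ => integrable_finsetSum _ fun l _ =>
      (h.integrable_mul_mul_mul i j k l).const_mul _

theorem integral_qform (h : IsotropicExch γ μ K₀) (B : Fin n → Fin n → ℝ) :
    ∫ x, qform B x ∂γ = ∑ i, B i i := by
  unfold qform
  rw [integral_finsetSum _ fun i _ => integrable_finsetSum _ fun j _ =>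
    (h.integrable_mul i j).const_mul _]
  refine Finset.sum_congr rfl fun i _ => ?_
  rw [integral_finsetSum _ fun j _ => (h.integrable_mul i j).const_mul _]
  simp [integral_const_mul, h.covariance]

theorem integral_qform_mul (h : IsotropicExch γ μ K₀) (B G : Fin n → Fin n → ℝ) :
    ∫ x, qform B x * qform G x ∂γ = ∑ i, ∑ j, ∑ k, ∑ l, B i j * G k l *
      ∫ x, x i * x j * x k * x l ∂γ := by
  have hi := fun i j k l => (h.integrable_mul_mul_mul i j k l).const_mul (B i j * G k l)
  simp_rw [qform_mul_qform]
  rw [integral_finsetSum _ fun i _ => integrable_finsetSum _ fun j _ =>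
    integrable_finsetSum _ fun k _ => integrable_finsetSum _ fun l _ => hi i j k l]
  refine Finset.sum_congr rfl fun i _ => ?_
  rw [integral_finsetSum _ fun j _ =>
    integrable_finsetSum _ fun k _ => integrable_finsetSum _ fun l _ => hi i j k l]
  refine Finset.sum_congr rfl fun j _ => ?_
  rw [integral_finsetSum _ fun k _ => integrable_finsetSum _ fun l _ => hi i j k l]
  refine Finset.sum_congr rfl fun k _ => ?_
  rw [integral_finsetSum _ fun l _ => hi i j k l]
  exact Finset.sum_congr rfl fun l _ => integral_const_mul _ _

theorem integral_perm (h : IsotropicExch γ μ K₀) (τ : Equiv.Perm (Fin n)) (i j k l : Fin n) :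
    ∫ x, x (τ i) * x (τ j) * x (τ k) * x (τ l) ∂γ = ∫ x, x i * x j * x k * x l ∂γ := by
  conv_rhs => rw [← h.exchangeable τ]
  rw [integral_map]
  · exact (by fun_prop : Continuous _).aemeasurable
  · exact (by fun_prop : Continuous _).aestronglyMeasurable

theorem integral_sum_sq_sub_sq_le (h : IsotropicExch γ μ K₀) :
    ∫ x, (qform kron x - n) ^ 2 ∂γ ≤ K₀ * n := by
  have := h.prob
  have hq : (fun x : EuclideanSpace ℝ (Fin n) => ∑ i, x i ^ 2) = qform kron := by
    funext x
    simp [qform, kron, pow_two]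
  have hm : ∫ x, qform kron x ∂γ = n := by rw [h.integral_qform]; simp
  have hv := h.variance_le
  rw [hq, variance_eq_integral (continuous_qform _).aemeasurable, hm] at hv
  exact hv

/-- The moments of `|x|²` and `(∑ xᵢ)²`: since `(∑ xᵢ)² ≤ n |x|²` and `|x|²` has variance
`O(n)`, the fourth moment of `∑ xᵢ` is `O(n³)`. -/
theorem sum_moment_bounds (h : IsotropicExch γ μ K₀) :
    (∫ x, qform kron x * qform kron x ∂γ - (n : ℝ) ^ 2 ≤ K₀ * n ∧
      0 ≤ ∫ x, qform kron x * qform kron x ∂γ - (n : ℝ) ^ 2) ∧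
    (∫ x, qform (fun _ _ => 1) x * qform kron x ∂γ ≤ (2 + K₀) * (n : ℝ) ^ 2 ∧
      0 ≤ ∫ x, qform (fun _ _ => 1) x * qform kron x ∂γ) ∧
    (∫ x, qform (fun _ _ => 1) x * qform (fun _ _ => 1) x ∂γ ≤ (2 + K₀) * (n : ℝ) ^ 3 ∧
      0 ≤ ∫ x, qform (fun _ _ => 1) x * qform (fun _ _ => 1) x ∂γ) := by
  have := h.prob
  set Q : EuclideanSpace ℝ (Fin n) → ℝ := qform kron with hQ
  set r : EuclideanSpace ℝ (Fin n) → ℝ := qform (fun _ _ => 1) with hr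
  have hQ0 : ∀ x, Q x = ∑ i, x i ^ 2 := fun x => by simp [hQ, qform, kron, pow_two]
  have hr0 : ∀ x, r x = (∑ i, x i) ^ 2 := fun x => by
    simp [hr, qform, pow_two, Finset.sum_mul_sum]
  have hQp : ∀ x, 0 ≤ Q x := fun x => by rw [hQ0]; positivity
  have hrp : ∀ x, 0 ≤ r x := fun x => by rw [hr0]; positivity
  have hrQ : ∀ x, r x ≤ n * Q x := fun x => by
    rw [hr0, hQ0]; simpa using sq_sum_le_card_mul_sum_sq (s := Finset.univ) (f := fun i => x i)
  have iQ : Integrable Q γ := h.integrable_qform _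
  have ir : Integrable r γ := h.integrable_qform _
  have iQQ : Integrable (fun x => Q x * Q x) γ := h.integrable_qform_mul _ _
  have irQ : Integrable (fun x => r x * Q x) γ := h.integrable_qform_mul _ _
  have irr : Integrable (fun x => r x * r x) γ := h.integrable_qform_mul _ _
  have eQ : ∫ x, Q x ∂γ = n := by rw [hQ, h.integral_qform]; simp
  have er : ∫ x, r x ∂γ = n := by rw [hr, h.integral_qform]; simp
  have hv := h.integral_sum_sq_sub_sq_le
  rw [← hQ] at hv
  have hv0 : 0 ≤ ∫ x, (Q x - n) ^ 2 ∂γ := integral_nonneg fun x => sq_nonneg _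
  have iv : Integrable (fun x => (Q x - n) ^ 2) γ := by
    refine ((iQQ.sub (iQ.const_mul (2 * n))).add (integrable_const ((n : ℝ) ^ 2))).congr
      (ae_of_all _ fun x => ?_)
    simp only [Pi.add_apply, Pi.sub_apply]; ring
  have ev : ∫ x, (Q x - n) ^ 2 ∂γ = ∫ x, Q x * Q x ∂γ - (n : ℝ) ^ 2 := by
    have : ∀ x, (Q x - n) ^ 2 = Q x * Q x - 2 * n * Q x + (n : ℝ) ^ 2 := fun x => by ring
    simp_rw [this]
    have i1 : Integrable (fun x => Q x * Q x - 2 * n * Q x) γ := iQQ.sub (iQ.const_mul _)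
    rw [integral_add i1 (integrable_const _),
      integral_sub iQQ (iQ.const_mul _), integral_const_mul, eQ]
    simp; ring
  have h3 : ∫ x, r x * r x ∂γ ≤ (2 + K₀) * (n : ℝ) ^ 3 := by
    -- `r² ≤ n r Q = n² r + n r (Q - n)`, and the last term is split by the AM-GM inequality
    have hle : ∫ x, r x * r x ∂γ ≤
        ∫ x, (2 * (n : ℝ) ^ 2 * r x + (n : ℝ) ^ 2 * (Q x - n) ^ 2) ∂γ := by
      refine integral_mono irr ((ir.const_mul _).add (iv.const_mul _)) fun x => ?_
      have h1 : r x * r x ≤ r x * (n * Q x) := mul_le_mul_of_nonneg_left (hrQ x) (hrp x)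
      nlinarith [sq_nonneg (r x - n * (Q x - n))]
    rw [integral_add (ir.const_mul _) (iv.const_mul _), integral_const_mul, integral_const_mul,
      er] at hle
    have : (n : ℝ) ^ 2 * ∫ x, (Q x - n) ^ 2 ∂γ ≤ (n : ℝ) ^ 2 * (K₀ * n) := by gcongr
    linarith
  refine ⟨⟨by linarith, by linarith⟩, ⟨?_, integral_nonneg fun x => mul_nonneg (hrp x) (hQp x)⟩,
    h3, integral_nonneg fun x => mul_nonneg (hrp x) (hrp x)⟩
  rcases Nat.eq_zero_or_pos n with hn | hn
  · subst hn
    simp [hQ0]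
  have hn' : (0 : ℝ) < n := by exact_mod_cast hn
  have hle : ∫ x, r x * Q x ∂γ ≤
      ∫ x, (n * r x + (1 / (2 * n) * (r x * r x) + n / 2 * (Q x - n) ^ 2)) ∂γ := by
    refine integral_mono irQ ((ir.const_mul _).add ((irr.const_mul _).add (iv.const_mul _)))
      fun x => ?_
    have : n * r x + (1 / (2 * n) * (r x * r x) + n / 2 * (Q x - n) ^ 2) - r x * Q x =
      1 / (2 * n) * (r x - n * (Q x - n)) ^ 2 := by field_simp; ring
    have h2 : 0 ≤ 1 / (2 * n) * (r x - n * (Q x - n)) ^ 2 := by positivity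
    linarith
  have i1 : Integrable (fun x => 1 / (2 * n) * (r x * r x) + n / 2 * (Q x - n) ^ 2) γ :=
    (irr.const_mul _).add (iv.const_mul _)
  rw [integral_add (ir.const_mul _) i1,
    integral_add (irr.const_mul _) (iv.const_mul _), integral_const_mul, integral_const_mul,
    integral_const_mul, er] at hle
  have h1 : 1 / (2 * n) * ∫ x, r x * r x ∂γ ≤ 1 / (2 * n) * ((2 + K₀) * (n : ℝ) ^ 3) := by gcongr
  have h2 : (n : ℝ) / 2 * ∫ x, (Q x - n) ^ 2 ∂γ ≤ n / 2 * (K₀ * n) := by gcongr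
  have h4 : 1 / (2 * n) * ((2 + K₀) * (n : ℝ) ^ 3) = (2 + K₀) * (n : ℝ) ^ 2 / 2 := by
    field_simp
  linarith

end IsotropicExch

theorem abs_le_of_mul_abs_le {N x K c : ℝ} {k : ℕ} (hN : 0 < N) (hc : N ^ (k + 1) ≤ 16 * c)
    (h : |c * x| ≤ K * N ^ k) : |x| ≤ 16 * K / N := by
  have hc0 : 0 < c := by have := pow_pos hN (k + 1); linarith
  rw [abs_mul, abs_of_pos hc0] at h
  rw [le_div_iff₀ hN]
  have h1 : N ^ (k + 1) * |x| ≤ 16 * (c * |x|) := by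
    calc _ ≤ 16 * c * |x| := by gcongr
      _ = _ := by ring
  have h2 : N ^ k * (|x| * N) ≤ N ^ k * (16 * K) := by
    calc _ = N ^ (k + 1) * |x| := by ring
      _ ≤ 16 * (K * N ^ k) := by linarith
      _ = _ := by ring
  exact le_of_mul_le_mul_left h2 (pow_pos hN k)

theorem abs_mul_falling_le {N x K : ℝ} (hN : 4 ≤ N) (hx : |x| ≤ K) :
    |N * (N - 1) * x| ≤ K * N ^ 2 := by
  have h0 : 0 ≤ N * (N - 1) := mul_nonneg (by linarith) (by linarith)
  rw [abs_mul, abs_of_nonneg h0, mul_comm K]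
  exact mul_le_mul (by nlinarith) hx (abs_nonneg x) (by positivity)

/-- The numerical content of the moment bounds: `a, b, d, e, f` are the moments of the five
shapes `x₁⁴`, `x₁³x₂`, `x₁²x₂²`, `x₁²x₂x₃`, `x₁x₂x₃x₄`, and the hypotheses bound the second
moment of `|x|²`, the mixed moment of `|x|²` and `(∑ xᵢ)²`, and the second moment of
`(∑ xᵢ)²`, written through them. -/
theorem shape_moment_bounds {N K₀ a b d e f K₁ K₂ K₃ K₄ : ℝ} (hN : 4 ≤ N) (hb : |b| ≤ a + d)
    (hA1 : N * a + N * (N - 1) * d - N ^ 2 ≤ K₀ * N)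
    (hA2 : 0 ≤ N * a + N * (N - 1) * d - N ^ 2)
    (hB1 : N * a + 2 * (N * (N - 1) * b) + N * (N - 1) * d + N * (N - 1) * (N - 2) * e
      ≤ (2 + K₀) * N ^ 2)
    (hB2 : 0 ≤ N * a + 2 * (N * (N - 1) * b) + N * (N - 1) * d + N * (N - 1) * (N - 2) * e)
    (hC1 : N * a + 4 * (N * (N - 1) * b) + 3 * (N * (N - 1) * d)
      + 6 * (N * (N - 1) * (N - 2) * e) + N * (N - 1) * (N - 2) * (N - 3) * f
      ≤ (2 + K₀) * N ^ 3)
    (hC2 : 0 ≤ N * a + 4 * (N * (N - 1) * b) + 3 * (N * (N - 1) * d)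
      + 6 * (N * (N - 1) * (N - 2) * e) + N * (N - 1) * (N - 2) * (N - 3) * f)
    (hK₁ : K₁ = 16 * (|K₀| + 1 + |a|)) (hK₂ : K₂ = |a| + (1 + K₁))
    (hK₃ : K₃ = 16 * (2 + |K₀| + |a| + 2 * K₂ + K₂))
    (hK₄ : K₄ = 16 * (2 + |K₀| + |a| + 4 * K₂ + 3 * K₂ + 6 * K₃)) :
    |f| ≤ K₄ / N ∧ |e| ≤ K₃ / N ∧ |d - 1| ≤ K₁ / N ∧ |b| ≤ K₂ ∧ |d| ≤ K₂ := by
  have p1 : 0 ≤ |K₀| := abs_nonneg _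
  have p2 : 0 ≤ |a| := abs_nonneg _
  have hN0 : 0 < N := by linarith
  have hK₀ := le_abs_self K₀
  have hK10 : 0 ≤ K₁ := by rw [hK₁]; positivity
  have hK20 : 0 ≤ K₂ := by rw [hK₂]; positivity
  have hK30 : 0 ≤ K₃ := by rw [hK₃]; positivity
  have hd1 : |d - 1| ≤ K₁ / N := by
    rw [hK₁]
    refine abs_le_of_mul_abs_le (c := N * (N - 1)) (k := 1) hN0 ?_ ?_
    · norm_num; nlinarith
    have e1 : N * (N - 1) * (d - 1) = (N * a + N * (N - 1) * d - N ^ 2) + N * (1 - a) := by ring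
    have h1 := mul_le_mul_of_nonneg_left (le_abs_self a) hN0.le
    have h2 := mul_le_mul_of_nonneg_left (neg_abs_le a) hN0.le
    have h3 := mul_le_mul_of_nonneg_left hK₀ hN0.le
    have h4 := mul_nonneg hN0.le p1
    rw [e1, abs_le]
    constructor <;> linarith
  have hdK : |d| ≤ 1 + K₁ := by
    have h1 : K₁ / N ≤ K₁ := div_le_self hK10 (by linarith)
    have h2 := abs_add_le (d - 1) 1
    simp only [sub_add_cancel, abs_one] at h2
    linarith
  have hbK : |b| ≤ K₂ := by linarith [le_abs_self a, le_abs_self d]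
  have hdK2 : |d| ≤ K₂ := by linarith
  have hNm : |N * a| ≤ |a| * N ^ 2 := by
    rw [abs_mul, abs_of_pos hN0, mul_comm]
    exact mul_le_mul_of_nonneg_left (by nlinarith) p2
  have hK02 : K₀ * N ^ 2 ≤ |K₀| * N ^ 2 := by gcongr
  have hK03 : K₀ * N ^ 3 ≤ |K₀| * N ^ 3 := by gcongr
  have pK2 : 0 ≤ |K₀| * N ^ 2 := by positivity
  have pK3 : 0 ≤ |K₀| * N ^ 3 := by positivity
  have hN12 : 3 / 8 * N ^ 2 ≤ (N - 1) * (N - 2) := by nlinarith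
  have he1 : |e| ≤ K₃ / N := by
    rw [hK₃]
    refine abs_le_of_mul_abs_le (c := N * (N - 1) * (N - 2)) (k := 2) hN0 ?_ ?_
    · have := mul_le_mul_of_nonneg_left hN12 hN0.le
      have := pow_pos hN0 3
      norm_num; linarith
    have h1 := abs_le.1 (abs_mul_falling_le hN hbK)
    have h2 := abs_le.1 (abs_mul_falling_le hN hdK2)
    have h3 := abs_le.1 hNm
    have h4 := pow_pos hN0 2
    rw [abs_le]
    constructor <;> linarith
  have hN23 : N ^ 2 ≤ N ^ 3 := pow_le_pow_right₀ (by linarith) (by norm_num)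
  have hcube : |N * (N - 1) * (N - 2) * e| ≤ K₃ * N ^ 2 := by
    have hx := he1
    rw [le_div_iff₀ hN0] at hx
    have h0 : 0 ≤ N * (N - 1) * (N - 2) :=
      mul_nonneg (mul_nonneg hN0.le (by linarith)) (by linarith)
    rw [abs_mul, abs_of_nonneg h0]
    have h1 : (N - 1) * (N - 2) ≤ N ^ 2 := by nlinarith
    have h2 := mul_le_mul_of_nonneg_left h1 hN0.le
    calc N * (N - 1) * (N - 2) * |e| ≤ N ^ 3 * |e| := by
          refine mul_le_mul_of_nonneg_right ?_ (abs_nonneg e)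
          linarith
      _ = (|e| * N) * N ^ 2 := by ring
      _ ≤ K₃ * N ^ 2 := by gcongr
  have lift : ∀ {y K : ℝ}, 0 ≤ K → |y| ≤ K * N ^ 2 → |y| ≤ K * N ^ 3 := fun hK hy =>
    hy.trans (mul_le_mul_of_nonneg_left hN23 hK)
  have hf1 : |f| ≤ K₄ / N := by
    rw [hK₄]
    refine abs_le_of_mul_abs_le (c := N * (N - 1) * (N - 2) * (N - 3)) (k := 3) hN0 ?_ ?_
    · have h2 : N / 4 ≤ N - 3 := by linarith
      have h3 : (3 : ℝ) / 8 * N ^ 2 * (N / 4) ≤ (N - 1) * (N - 2) * (N - 3) :=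
        mul_le_mul hN12 h2 (by positivity) (mul_nonneg (by linarith) (by linarith))
      have h4 := mul_le_mul_of_nonneg_left h3 hN0.le
      have := pow_pos hN0 4
      norm_num; linarith
    have h1 := abs_le.1 (lift hK20 (abs_mul_falling_le hN hbK))
    have h2 := abs_le.1 (lift hK20 (abs_mul_falling_le hN hdK2))
    have h3 := abs_le.1 (lift p2 hNm)
    have h4 := abs_le.1 (lift hK30 hcube)
    have h5 := pow_pos hN0 3
    rw [abs_le]
    constructor <;> linarith
  exact ⟨hf1, he1, hd1, hbK, hdK2⟩

/-- The fourth moments of an exchangeable isotropic vector with `Var |x|² = O(n)` are, up to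
`O(1/n)` and terms supported on triple coincidences of indices, those of a Gaussian vector. -/
theorem exists_moment_bounds (μ K₀ : ℝ) : ∃ K : ℝ, 0 < K ∧ ∀ (n : ℕ) (_ : 4 ≤ n)
    (γ : Measure (EuclideanSpace ℝ (Fin n))) (_ : IsotropicExch γ μ K₀), ∃ f e d b a : ℝ,
      (∀ i j k l, ∫ x, x i * x j * x k * x l ∂γ = invTensor f e d b a i j k l) ∧
      |f| ≤ K / n ∧ |e| ≤ K / n ∧ |d - 1| ≤ K / n ∧ |b| ≤ K ∧ |a| ≤ K := by
  obtain ⟨K₁, hK₁⟩ : ∃ K₁, K₁ = 16 * (|K₀| + 1 + |μ|) := ⟨_, rfl⟩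
  obtain ⟨K₂, hK₂⟩ : ∃ K₂, K₂ = |μ| + (1 + K₁) := ⟨_, rfl⟩
  obtain ⟨K₃, hK₃⟩ : ∃ K₃, K₃ = 16 * (2 + |K₀| + |μ| + 2 * K₂ + K₂) := ⟨_, rfl⟩
  obtain ⟨K₄, hK₄⟩ : ∃ K₄, K₄ = 16 * (2 + |K₀| + |μ| + 4 * K₂ + 3 * K₂ + 6 * K₃) := ⟨_, rfl⟩
  have p1 : 0 ≤ |K₀| := abs_nonneg _
  have p2 : 0 ≤ |μ| := abs_nonneg _
  have hK10 : 0 < K₁ := by rw [hK₁]; positivity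
  have hK20 : 0 < K₂ := by rw [hK₂]; positivity
  have hK30 : 0 < K₃ := by rw [hK₃]; positivity
  have hK40 : 0 < K₄ := by rw [hK₄]; positivity
  refine ⟨|μ| + 7 * K₂ + 12 * K₃ + 6 * K₄ + K₁, by positivity, fun n hn γ h => ?_⟩
  have hN : (4 : ℝ) ≤ n := by exact_mod_cast hn
  have hN0 : (0 : ℝ) < n := by linarith
  obtain ⟨i₁, i₂, i₃, i₄, -, -, -, -, -, -, a, b, d, e, f, ha, hb, hd, -, -, hT⟩ :=
    eq_invTensor (fun i j k l => ∫ x, x i * x j * x k * x l ∂γ) hn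
      (fun i j k l => by congr 1; funext x; ring) (fun i j k l => by congr 1; funext x; ring)
      (fun i j k l => by congr 1; funext x; ring) h.integral_perm
  have ham : a = μ := by
    rw [ha, ← h.fourth i₁]; congr 1; funext x; ring
  have hbad : |b| ≤ a + d := by
    have hi1 := h.integrable_mul_mul_mul i₁ i₁ i₁ i₁
    have hi2 := h.integrable_mul_mul_mul i₁ i₁ i₂ i₂
    rw [ha, hb, hd, ← integral_add hi1 hi2]
    refine abs_integral_le_integral_abs.trans
      (integral_mono (h.integrable_mul_mul_mul _ _ _ _).abs (hi1.add hi2) fun x => ?_)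
    simp only [abs_le]
    constructor <;> nlinarith [sq_nonneg (x i₁ * x i₁ - x i₁ * x i₂),
      sq_nonneg (x i₁ * x i₁ + x i₁ * x i₂), sq_nonneg (x i₁ * x i₁), sq_nonneg (x i₁ * x i₂)]
  obtain ⟨⟨hA1, hA2⟩, ⟨hB1, hB2⟩, hC1, hC2⟩ := h.sum_moment_bounds
  simp only [h.integral_qform_mul, hT] at hA1 hA2 hB1 hB2 hC1 hC2
  have ksymm : ∀ i j : Fin n, kron i j = kron j i := fun i j => by simp [kron, eq_comm]
  have ksum : ∀ i : Fin n, ∑ j, kron i j = 1 := fun i => by simp [kron]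
  have ksum2 : ∀ i : Fin n, ∑ j, kron i j * kron i j = 1 := fun i => by simp [kron]
  rw [sum_mul_invTensor _ _ ksymm ksymm] at hA1 hA2
  rw [sum_mul_invTensor _ _ (fun _ _ => rfl) ksymm] at hB1 hB2
  rw [sum_mul_invTensor _ _ (fun _ _ => rfl) (fun _ _ => rfl)] at hC1 hC2
  simp only [ksum, ksum2, kron_self, Finset.sum_const, Finset.card_univ, Fintype.card_fin,
    nsmul_eq_mul, mul_one, one_mul] at hA1 hA2 hB1 hB2 hC1 hC2
  rw [← ham] at hK₁ hK₂ hK₃ hK₄ p2 ⊢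
  obtain ⟨hf1, he1, hd1, hbK, hdK2⟩ := shape_moment_bounds (e := e) (f := f) hN hbad
    (by ring_nf at hA1 ⊢; exact hA1) (by ring_nf at hA2 ⊢; exact hA2)
    (by ring_nf at hB1 ⊢; exact hB1) (by ring_nf at hB2 ⊢; exact hB2)
    (by ring_nf at hC1 ⊢; exact hC1) (by ring_nf at hC2 ⊢; exact hC2) hK₁ hK₂ hK₃ hK₄
  have heK : |e| ≤ K₃ := he1.trans (div_le_self hK30.le (by linarith))
  have hfK : |f| ≤ K₄ := hf1.trans (div_le_self hK40.le (by linarith))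
  clear hA1 hA2 hB1 hB2 hC1 hC2 hK₁ hK₂ hK₃ hK₄ ha hb hd
  refine ⟨_, _, _, _, _, hT, ?_, ?_, ?_, ?_, ?_⟩
  · refine hf1.trans ?_
    exact div_le_div_of_nonneg_right (by linarith) hN0.le
  · refine (abs_sub _ _).trans ?_
    refine (add_le_add he1 hf1).trans ?_
    rw [← add_div]
    exact div_le_div_of_nonneg_right (by linarith) hN0.le
  · have : |d - 2 * e + f - 1| ≤ K₁ / n + 2 * (K₃ / n) + K₄ / n := by
      have h1 := abs_le.1 hd1
      have h2 := abs_le.1 he1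
      have h3 := abs_le.1 hf1
      rw [abs_le]; constructor <;> linarith
    refine this.trans ?_
    rw [← mul_div_assoc, ← add_div, ← add_div]
    exact div_le_div_of_nonneg_right (by linarith) hN0.le
  · have h1 := abs_le.1 hbK
    have h2 := abs_le.1 heK
    have h3 := abs_le.1 hfK
    rw [abs_le]; constructor <;> linarith
  · have h1 := abs_le.1 hbK
    have h2 := abs_le.1 heK
    have h3 := abs_le.1 hfK
    have h4 := abs_le.1 hdK2
    have h5 := le_abs_self a
    have h6 := neg_abs_le a
    rw [abs_le]; constructor <;> linarith

/-! ### Quadratic and linear forms -/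

/-- Second-moment bounds for quadratic forms and fourth-moment bounds for linear forms of a random
vector, with constant `K`. The hypotheses on `B` hold when `B` is symmetric of operator norm at
most `β`. -/
structure FormBounds {n : ℕ} (γ : Measure (EuclideanSpace ℝ (Fin n))) (K : ℝ) : Prop where
  quad : ∀ (B : Fin n → Fin n → ℝ) (β : ℝ), (∀ i j, B i j = B j i) →
    (∑ i, ∑ j, B i j ^ 2 ≤ n * β ^ 2) → (∑ i, (∑ j, B i j) ^ 2 ≤ n * β ^ 2) →
    Integrable (fun x => (qform B x - ∑ i, B i i) ^ 2) γ ∧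
    ∫ x, (qform B x - ∑ i, B i i) ^ 2 ∂γ ≤ K * (n * β ^ 2)
  lin : ∀ u : Fin n → ℝ,
    Integrable (fun x : EuclideanSpace ℝ (Fin n) => (∑ i, u i * x i) ^ 4) γ ∧
    ∫ x, (∑ i, u i * x i) ^ 4 ∂γ ≤ K * (∑ i, u i ^ 2) * (∑ i, u i ^ 2 + (∑ i, u i) ^ 2)

set_option maxHeartbeats 800000 in
/-- An exchangeable isotropic vector satisfies `FormBounds` with a constant independent of `n`: the
Gaussian part of its moment tensor gives the main terms, and each correction of order `1 / n` meets
a contraction at most `n` times larger. -/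
theorem exists_form_bounds (μ K₀ : ℝ) : ∃ K : ℝ, 0 < K ∧ ∀ (n : ℕ) (_ : 4 ≤ n)
    (γ : Measure (EuclideanSpace ℝ (Fin n))) (_ : IsotropicExch γ μ K₀), FormBounds γ K := by
  obtain ⟨K, hK, hm⟩ := exists_moment_bounds μ K₀
  refine ⟨100 * (K + 1), by positivity, fun n hn γ h => ?_⟩
  have := h.prob
  have hN : (4 : ℝ) ≤ n := by exact_mod_cast hn
  have hN0 : (0 : ℝ) < n := by linarith
  obtain ⟨f, e, d, b, a, hT, hf, he, hd, hb, ha⟩ := hm n hn γ h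
  have hKn : K / n ≤ K := div_le_self hK.le (by linarith)
  have hdK : |d| ≤ K + 1 := by
    have h2 := abs_add_le (d - 1) 1
    simp only [sub_add_cancel, abs_one] at h2
    linarith
  have cs : ∀ u : Fin n → ℝ, (∑ i, u i) ^ 2 ≤ n * ∑ i, u i ^ 2 := fun u => by
    simpa using sq_sum_le_card_mul_sum_sq (s := Finset.univ) (f := u)
  have cs2 : ∀ u w : Fin n → ℝ, (∑ i, u i * w i) ^ 2 ≤ (∑ i, u i ^ 2) * ∑ i, w i ^ 2 :=
    fun u w => Finset.sum_mul_sq_le_sq_mul_sq _ _ _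
  constructor
  · intro B β hB h1 h2
    set D := ∑ i, B i i with hD
    have iQ := h.integrable_qform B
    have iQQ := h.integrable_qform_mul B B
    have ii : Integrable (fun x => (qform B x - D) ^ 2) γ := by
      refine ((iQQ.sub (iQ.const_mul (2 * D))).add (integrable_const (D ^ 2))).congr
        (ae_of_all _ fun x => ?_)
      simp only [Pi.add_apply, Pi.sub_apply]; ring
    refine ⟨ii, ?_⟩
    have ev : ∫ x, (qform B x - D) ^ 2 ∂γ = ∫ x, qform B x * qform B x ∂γ - D ^ 2 := by
      have : ∀ x, (qform B x - D) ^ 2 = qform B x * qform B x - 2 * D * qform B x + D ^ 2 :=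
        fun x => by ring
      simp_rw [this]
      have i1 : Integrable (fun x => qform B x * qform B x - 2 * D * qform B x) γ :=
        iQQ.sub (iQ.const_mul _)
      rw [integral_add i1 (integrable_const _), integral_sub iQQ (iQ.const_mul _),
        integral_const_mul, h.integral_qform]
      simp; ring
    rw [ev, h.integral_qform_mul]
    simp_rw [hT]
    rw [sum_mul_invTensor B B hB hB]
    have hdiag : ∑ i, B i i ^ 2 ≤ n * β ^ 2 := h1.trans' <| Finset.sum_le_sum fun i _ =>
      Finset.single_le_sum (f := fun j => B i j ^ 2) (fun j _ => sq_nonneg _) (Finset.mem_univ i)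
    have hD2 : D ^ 2 ≤ n ^ 2 * β ^ 2 := by
      refine (cs fun i => B i i).trans ?_
      have := mul_le_mul_of_nonneg_left hdiag hN0.le
      linarith
    set s := ∑ i, ∑ j, B i j with hs
    have hs2 : s ^ 2 ≤ n ^ 2 * β ^ 2 := by
      refine (cs fun i => ∑ j, B i j).trans ?_
      have := mul_le_mul_of_nonneg_left h2 hN0.le
      linarith
    simp_rw [← pow_two]
    have hcross : |∑ i, B i i * ∑ j, B i j| ≤ n * β ^ 2 := by
      refine abs_le_of_sq_le_sq ((cs2 _ _).trans ?_) (by positivity)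
      rw [pow_two]
      exact mul_le_mul hdiag h2 (by positivity) (by positivity)
    have hcross2 : ∑ i, (∑ j, B i j) * B i i = ∑ i, B i i * ∑ j, B i j :=
      Finset.sum_congr rfl fun i _ => mul_comm _ _
    rw [hcross2]
    have hDs : |D * s| ≤ n ^ 2 * β ^ 2 := by
      rw [abs_le]; constructor <;> nlinarith [sq_nonneg (D - s), sq_nonneg (D + s)]
    have tm : ∀ {x y A M : ℝ}, |x| ≤ A → |y| ≤ M → x * y ≤ A * M := fun {x y A M} hx hy => by
      refine (le_abs_self _).trans ?_
      rw [abs_mul]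
      exact mul_le_mul hx hy (abs_nonneg _) ((abs_nonneg _).trans hx)
    have q0 : 0 ≤ n * β ^ 2 := by positivity
    have q1 : 0 ≤ ∑ i, (∑ j, B i j) ^ 2 := by positivity
    have q2 : 0 ≤ ∑ i, ∑ j, B i j ^ 2 := by positivity
    have q3 : 0 ≤ ∑ i, B i i ^ 2 := by positivity
    have t1 : f * s ^ 2 ≤ K / n * (n ^ 2 * β ^ 2) :=
      tm hf (by rw [abs_of_nonneg (sq_nonneg _)]; exact hs2)
    have t2 : e * (D * s + s * D + 4 * ∑ i, (∑ j, B i j) ^ 2) ≤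
        K / n * (2 * (n ^ 2 * β ^ 2) + 4 * (n * β ^ 2)) := by
      refine tm he ?_
      have := abs_le.1 hDs
      rw [abs_le]; constructor <;> nlinarith
    have t3 : (d - 1) * D ^ 2 ≤ K / n * (n ^ 2 * β ^ 2) :=
      tm hd (by rw [abs_of_nonneg (sq_nonneg _)]; exact hD2)
    have t4 : d * (2 * ∑ i, ∑ j, B i j ^ 2) ≤ (K + 1) * (2 * (n * β ^ 2)) :=
      tm hdK (by rw [abs_of_nonneg (by positivity)]; linarith)
    have t5 : b * (2 * ∑ i, B i i * ∑ j, B i j + 2 * ∑ i, B i i * ∑ j, B i j) ≤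
        K * (4 * (n * β ^ 2)) := by
      refine tm hb ?_
      have := abs_le.1 hcross
      rw [abs_le]; constructor <;> linarith
    have t6 : a * ∑ i, B i i ^ 2 ≤ K * (n * β ^ 2) :=
      tm ha (by rw [abs_of_nonneg q3]; exact hdiag)
    have e1 : K / n * (n ^ 2 * β ^ 2) = K * (n * β ^ 2) := by field_simp
    have e2 : K / n * (4 * (n * β ^ 2)) ≤ K * (4 * (n * β ^ 2)) := by gcongr
    have e3 := mul_nonneg hK.le q0
    linarith
  · intro u
    set p := ∑ i, u i ^ 2 with hp
    set t := ∑ i, u i with ht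
    have hq : ∀ x : EuclideanSpace ℝ (Fin n), (∑ i, u i * x i) ^ 4 =
        qform (fun i j => u i * u j) x * qform (fun i j => u i * u j) x := fun x => by
      have : qform (fun i j => u i * u j) x = (∑ i, u i * x i) ^ 2 := by
        rw [qform, pow_two, Finset.sum_mul_sum]
        exact Finset.sum_congr rfl fun i _ => Finset.sum_congr rfl fun j _ => by ring
      rw [this]; ring
    simp_rw [hq]
    refine ⟨h.integrable_qform_mul _ _, ?_⟩
    rw [h.integral_qform_mul]
    simp_rw [hT]
    rw [sum_mul_invTensor _ _ (fun i j => mul_comm _ _) (fun i j => mul_comm _ _)]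
    simp_rw [← Finset.mul_sum, ← Finset.sum_mul]
    have q1 : ∑ i, u i * u i = p := Finset.sum_congr rfl fun i _ => (pow_two _).symm
    have q2 : ∑ i, u i * t * (u i * t) = p * t ^ 2 := by
      rw [hp, Finset.sum_mul]; exact Finset.sum_congr rfl fun i _ => by ring
    have q3 : ∑ i, ∑ j, u i * u j * (u i * u j) = p * p := by
      rw [hp, Finset.sum_mul_sum]
      exact Finset.sum_congr rfl fun i _ => Finset.sum_congr rfl fun j _ => by ring
    set c := ∑ i, u i ^ 3 with hc
    have q4 : ∑ i, u i * u i * (u i * t) = c * t := by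
      rw [hc, Finset.sum_mul]; exact Finset.sum_congr rfl fun i _ => by ring
    have q5 : ∑ i, u i * t * (u i * u i) = c * t := by
      rw [hc, Finset.sum_mul]; exact Finset.sum_congr rfl fun i _ => by ring
    have q6 : ∑ i, u i * u i * (u i * u i) = ∑ i, (u i ^ 2) ^ 2 :=
      Finset.sum_congr rfl fun i _ => by ring
    rw [q1, q2, q3, q4, q5, q6]
    have hp0 : 0 ≤ p := by positivity
    have hq0 : 0 ≤ ∑ i, (u i ^ 2) ^ 2 := by positivity
    have h4 : ∑ i, (u i ^ 2) ^ 2 ≤ p ^ 2 :=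
      Finset.sum_sq_le_sq_sum_of_nonneg fun i _ => sq_nonneg _
    have hc2 : c ^ 2 ≤ p * p ^ 2 := by
      have := cs2 u (fun i => u i ^ 2)
      have e : ∑ i, u i * u i ^ 2 = c := Finset.sum_congr rfl fun i _ => by ring
      rw [e] at this
      exact this.trans (mul_le_mul_of_nonneg_left h4 hp0)
    have hct : |c * t| ≤ p ^ 2 + p * t ^ 2 := by
      refine abs_le_of_sq_le_sq ?_ (by positivity)
      calc (c * t) ^ 2 = c ^ 2 * t ^ 2 := by ring
        _ ≤ p * p ^ 2 * t ^ 2 := by gcongr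
        _ = p ^ 2 * (p * t ^ 2) := by ring
        _ ≤ (p ^ 2 + p * t ^ 2) ^ 2 := by
          have h1 : 0 ≤ p ^ 2 := by positivity
          have h2 : 0 ≤ p * t ^ 2 := by positivity
          nlinarith
    have ht2 : t ^ 2 ≤ n * p := cs u
    have tm : ∀ {x y A M : ℝ}, |x| ≤ A → |y| ≤ M → x * y ≤ A * M := fun {x y A M} hx hy => by
      refine (le_abs_self _).trans ?_
      rw [abs_mul]
      exact mul_le_mul hx hy (abs_nonneg _) ((abs_nonneg _).trans hx)
    have r1 : 0 ≤ p * t ^ 2 := by positivity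
    have r2 : 0 ≤ p ^ 2 := by positivity
    have t1 : f * (t * t * (t * t)) ≤ K / n * (n * (p * t ^ 2)) := by
      refine tm hf ?_
      have e0 : t * t * (t * t) = t ^ 2 * t ^ 2 := by ring
      rw [e0, abs_of_nonneg (by positivity), ← mul_assoc]
      gcongr
    have e1 : K / n * (n * (p * t ^ 2)) = K * (p * t ^ 2) := by field_simp
    have t2 : e * (p * (t * t) + t * t * p + 4 * (p * t ^ 2)) ≤ K * (6 * (p * t ^ 2)) := by
      refine tm (he.trans hKn) ?_
      have e2 : p * (t * t) + t * t * p + 4 * (p * t ^ 2) = 6 * (p * t ^ 2) := by ring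
      rw [e2, abs_of_nonneg (by positivity)]
    have t3 : d * (p * p + 2 * (p * p)) ≤ (K + 1) * (3 * p ^ 2) := by
      refine tm hdK ?_
      have e2 : p * p + 2 * (p * p) = 3 * p ^ 2 := by ring
      rw [e2, abs_of_nonneg (by positivity)]
    have t4 : b * (2 * (c * t) + 2 * (c * t)) ≤ K * (4 * (p ^ 2 + p * t ^ 2)) := by
      refine tm hb ?_
      have := abs_le.1 hct
      rw [abs_le]; constructor <;> linarith
    have t5 : a * ∑ i, (u i ^ 2) ^ 2 ≤ K * p ^ 2 :=
      tm ha (by rw [abs_of_nonneg hq0]; exact h4)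
    have e3 := mul_nonneg hK.le r1
    have e4 := mul_nonneg hK.le r2
    linarith

/-! ### Resolvents of the linearized covariance matrix -/

section Resolvent

variable {n m : ℕ} (X : Fin m → EuclideanSpace ℝ (Fin n)) {z : ℂ}

/-- The matrix `W - z`. -/
def shifted (z : ℂ) : Matrix (Fin m ⊕ Fin n) (Fin m ⊕ Fin n) ℂ :=
  (Wmat X).map (fun t : ℝ => (t : ℂ)) - z • (1 : Matrix (Fin m ⊕ Fin n) (Fin m ⊕ Fin n) ℂ)

theorem Wmat_transpose : (Wmat X).transpose = Wmat X := by
  simp [Wmat, Matrix.fromBlocks_transpose]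

theorem shifted_transpose : (shifted X z).transpose = shifted X z := by
  rw [shifted, Matrix.transpose_sub, Matrix.transpose_smul, Matrix.transpose_one,
    ← Matrix.transpose_map, Wmat_transpose]

/-- A Hermitian matrix has a real quadratic form, so only `z` contributes to the imaginary part. -/
theorem im_star_dotProduct_shifted (u : Fin m ⊕ Fin n → ℂ) :
    (star u ⬝ᵥ (shifted X z).mulVec u).im = -z.im * ∑ i, ‖u i‖ ^ 2 := by
  have hH : ((Wmat X).map (fun t : ℝ => (t : ℂ))).IsHermitian := by
    ext i j
    have := congrFun (congrFun (Wmat_transpose X) i) j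
    simp only [Matrix.transpose_apply] at this
    simp [Matrix.conjTranspose_apply, this]
  have h1 : (star u ⬝ᵥ ((Wmat X).map (fun t : ℝ => (t : ℂ))).mulVec u).im = 0 :=
    hH.im_star_dotProduct_mulVec_self u
  have h2 : star u ⬝ᵥ u = ((∑ i, ‖u i‖ ^ 2 : ℝ) : ℂ) := by
    rw [dotProduct]
    push_cast
    exact Finset.sum_congr rfl fun i _ => by
      simp only [Pi.star_apply, RCLike.star_def]
      exact Complex.conj_mul' _
  rw [shifted, Matrix.sub_mulVec, Matrix.smul_mulVec, Matrix.one_mulVec, dotProduct_sub,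
    dotProduct_smul, h2, Complex.sub_im, h1, smul_eq_mul, Complex.mul_im, Complex.ofReal_im,
    Complex.ofReal_re]
  ring

theorem det_shifted_ne_zero (hz : z.im ≠ 0) : (shifted X z).det ≠ 0 := by
  intro h
  obtain ⟨u, hu, h0⟩ := Matrix.exists_mulVec_eq_zero_iff.2 h
  have := im_star_dotProduct_shifted X (z := z) u
  rw [h0] at this
  simp only [dotProduct_zero, Complex.zero_im, neg_mul, zero_eq_neg, mul_eq_zero, hz, false_or]
    at this
  refine hu (funext fun i => ?_)
  have h3 := (Finset.sum_eq_zero_iff_of_nonneg (fun i _ => sq_nonneg ‖u i‖)).1 this i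
    (Finset.mem_univ i)
  simpa using h3

theorem resolvent_eq : resolvent X z = (shifted X z)⁻¹ := rfl

theorem shifted_mul_resolvent (hz : z.im ≠ 0) : shifted X z * resolvent X z = 1 :=
  Matrix.mul_nonsing_inv _ (isUnit_iff_ne_zero.2 (det_shifted_ne_zero X hz))

theorem resolvent_mul_shifted (hz : z.im ≠ 0) : resolvent X z * shifted X z = 1 :=
  Matrix.nonsing_inv_mul _ (isUnit_iff_ne_zero.2 (det_shifted_ne_zero X hz))

theorem resolvent_symm (a b : Fin m ⊕ Fin n) : resolvent X z a b = resolvent X z b a := by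
  have : (resolvent X z).transpose = resolvent X z := by
    rw [resolvent_eq, Matrix.transpose_nonsing_inv, shifted_transpose]
  exact (congrFun (congrFun this b) a)

/-- The Ward identity. -/
theorem ward (hz : z.im ≠ 0) (j : Fin m ⊕ Fin n) :
    z.im * ∑ i, ‖resolvent X z i j‖ ^ 2 = (resolvent X z j j).im := by
  have h := im_star_dotProduct_shifted X (z := z) (fun i => resolvent X z i j)
  have h1 : (shifted X z).mulVec (fun i => resolvent X z i j) = Pi.single j 1 := by
    funext i
    have := congrFun (congrFun (shifted_mul_resolvent X hz) i) j
    rw [Matrix.mul_apply] at this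
    rw [Matrix.mulVec, dotProduct, this, Matrix.one_apply, Pi.single_apply]
  rw [h1, dotProduct_single] at h
  simp only [Pi.star_apply, RCLike.star_def, mul_one, Complex.conj_im] at h
  linarith

theorem im_resolvent_mul_nonneg (hz : z.im ≠ 0) (j : Fin m ⊕ Fin n) :
    0 ≤ (resolvent X z j j).im * z.im := by
  rw [← ward X hz]
  have : 0 ≤ ∑ i, ‖resolvent X z i j‖ ^ 2 := by positivity
  nlinarith [mul_self_nonneg z.im]

theorem abs_im_mul_sum_le (hz : z.im ≠ 0) (j : Fin m ⊕ Fin n) :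
    |z.im| * ∑ i, ‖resolvent X z i j‖ ^ 2 ≤ ‖resolvent X z j j‖ := by
  have h0 : 0 ≤ ∑ i, ‖resolvent X z i j‖ ^ 2 := by positivity
  have : |z.im| * ∑ i, ‖resolvent X z i j‖ ^ 2 = |(resolvent X z j j).im| := by
    rw [← ward X hz, abs_mul, abs_of_nonneg h0]
  rw [this]
  exact Complex.abs_im_le_norm _

theorem norm_resolvent_diag_le (hz : z.im ≠ 0) (j : Fin m ⊕ Fin n) :
    ‖resolvent X z j j‖ ≤ 1 / |z.im| := by
  have hv : 0 < |z.im| := abs_pos.2 hz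
  have h1 := abs_im_mul_sum_le X hz j
  have h2 : ‖resolvent X z j j‖ ^ 2 ≤ ∑ i, ‖resolvent X z i j‖ ^ 2 :=
    Finset.single_le_sum (f := fun i => ‖resolvent X z i j‖ ^ 2) (fun i _ => sq_nonneg _)
      (Finset.mem_univ j)
  rw [le_div_iff₀ hv]
  have h3 := (mul_le_mul_of_nonneg_left h2 hv.le).trans h1
  rcases (norm_nonneg (resolvent X z j j)).eq_or_lt with h | h
  · rw [← h]; simp
  · nlinarith

theorem sum_norm_sq_resolvent_le (hz : z.im ≠ 0) (j : Fin m ⊕ Fin n) :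
    ∑ i, ‖resolvent X z i j‖ ^ 2 ≤ 1 / z.im ^ 2 := by
  have hv : 0 < |z.im| := abs_pos.2 hz
  have h1 := (abs_im_mul_sum_le X hz j).trans (norm_resolvent_diag_le X hz j)
  rw [← sq_abs, le_div_iff₀ (by positivity)]
  rw [le_div_iff₀ hv] at h1
  linarith

/-- The resolvent has norm at most `1 / |Im z|`. -/
theorem sum_norm_sq_resolvent_mulVec_le (hz : z.im ≠ 0) (w : Fin m ⊕ Fin n → ℂ) :
    ∑ i, ‖(resolvent X z).mulVec w i‖ ^ 2 ≤ (∑ i, ‖w i‖ ^ 2) / z.im ^ 2 := by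
  set u := (resolvent X z).mulVec w with hu
  have h := im_star_dotProduct_shifted X (z := z) u
  rw [hu, Matrix.mulVec_mulVec, shifted_mul_resolvent X hz, Matrix.one_mulVec, ← hu] at h
  have hs : 0 ≤ ∑ i, ‖u i‖ ^ 2 := by positivity
  have h1 : |z.im| * ∑ i, ‖u i‖ ^ 2 ≤ ∑ i, ‖u i‖ * ‖w i‖ := by
    calc |z.im| * ∑ i, ‖u i‖ ^ 2 = |(star u ⬝ᵥ w).im| := by
          rw [h, abs_mul, abs_neg, abs_of_nonneg hs]
      _ ≤ ‖star u ⬝ᵥ w‖ := Complex.abs_im_le_norm _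
      _ ≤ ∑ i, ‖u i‖ * ‖w i‖ := by
          rw [dotProduct]
          exact (norm_sum_le _ _).trans (Finset.sum_le_sum fun i _ => by simp)
  have h2 : (∑ i, ‖u i‖ * ‖w i‖) ^ 2 ≤ (∑ i, ‖u i‖ ^ 2) * ∑ i, ‖w i‖ ^ 2 :=
    Finset.sum_mul_sq_le_sq_mul_sq _ _ _
  have hz2 : 0 < z.im ^ 2 := by positivity
  rw [le_div_iff₀ hz2]
  have h3 : (|z.im| * ∑ i, ‖u i‖ ^ 2) ^ 2 ≤ (∑ i, ‖u i‖ ^ 2) * ∑ i, ‖w i‖ ^ 2 :=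
    (pow_le_pow_left₀ (by positivity) h1 2).trans h2
  rw [mul_pow, sq_abs] at h3
  have hw : 0 ≤ ∑ i, ‖w i‖ ^ 2 := by positivity
  rcases hs.eq_or_lt with h0 | h0
  · rw [← h0]; simpa using hw
  · nlinarith

/-! ### Removing one column -/

/-- The `k`-th column of `Y`, as a complex vector. -/
def col (k : Fin m) (i : Fin n) : ℂ := ((X k i / Real.sqrt n : ℝ) : ℂ)

theorem shifted_inl_inl (l l' : Fin m) :
    shifted X z (Sum.inl l) (Sum.inl l') = if l = l' then -z else 0 := by
  by_cases h : l = l' <;> simp [shifted, Wmat, h]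

theorem shifted_inl_inr (l : Fin m) (i : Fin n) :
    shifted X z (Sum.inl l) (Sum.inr i) = col X l i := by
  simp [shifted, Wmat, Ymat, col]

theorem shifted_inr_inl (l : Fin m) (i : Fin n) :
    shifted X z (Sum.inr i) (Sum.inl l) = col X l i := by
  simp [shifted, Wmat, Ymat, col]

theorem shifted_inr_inr (i j : Fin n) :
    shifted X z (Sum.inr i) (Sum.inr j) = if i = j then -z else 0 := by
  by_cases h : i = j <;> simp [shifted, Wmat, h]

/-- The resolvent of the model whose `k`-th column is removed. The column is replaced by zero, so
that the index set stays the same; the index `k` then decouples from the others. -/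
def minor (k : Fin m) (z : ℂ) : Matrix (Fin m ⊕ Fin n) (Fin m ⊕ Fin n) ℂ :=
  resolvent (Function.update X k 0) z

theorem col_update_self (k : Fin m) (i : Fin n) : col (Function.update X k 0) k i = 0 := by
  simp [col]

theorem col_update_of_ne {k l : Fin m} (h : l ≠ k) (i : Fin n) :
    col (Function.update X k 0) l i = col X l i := by
  simp [col, Function.update_of_ne h]

theorem minor_inl_self (hz : z.im ≠ 0) (k : Fin m) (b : Fin m ⊕ Fin n) :
    z * minor X k z (Sum.inl k) b = if Sum.inl k = b then -1 else 0 := by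
  have := congrFun (congrFun (shifted_mul_resolvent (Function.update X k 0) hz) (Sum.inl k)) b
  rw [Matrix.mul_apply, Fintype.sum_sum_type, Matrix.one_apply] at this
  simp only [shifted_inl_inl, shifted_inl_inr, col_update_self, ite_mul, zero_mul,
    Finset.sum_ite_eq, Finset.mem_univ, if_true, Finset.sum_const_zero, add_zero] at this
  rw [minor]
  split_ifs at this ⊢ <;> linear_combination -this

/-- The vector `S^{(k)} y_k`. -/
def minorVec (k : Fin m) (z : ℂ) (i : Fin n) : ℂ :=
  ∑ j, minor X k z (Sum.inr i) (Sum.inr j) * col X k j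

/-- The quadratic form `y_kᵀ S^{(k)} y_k`. -/
def minorForm (k : Fin m) (z : ℂ) : ℂ := ∑ i, col X k i * minorVec X k z i

/-- The rank-two resolvent identity. -/
theorem resolvent_eq_minor (hz : z.im ≠ 0) (k : Fin m) (a b : Fin m ⊕ Fin n) :
    resolvent X z a b = minor X k z a b
      - minor X k z a (Sum.inl k) * ∑ i, col X k i * resolvent X z (Sum.inr i) b
      - (∑ i, minor X k z a (Sum.inr i) * col X k i) * resolvent X z (Sum.inl k) b := by
  have h : minor X k z - resolvent X z =
      minor X k z * ((shifted X z - shifted (Function.update X k 0) z) * resolvent X z) := by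
    have h2 : minor X k z * shifted (Function.update X k 0) z = 1 :=
      resolvent_mul_shifted (Function.update X k 0) hz
    rw [Matrix.sub_mul, Matrix.mul_sub, shifted_mul_resolvent X hz, Matrix.mul_one,
      ← Matrix.mul_assoc, h2, Matrix.one_mul]
  have hab := congrFun (congrFun h a) b
  rw [Matrix.sub_apply, Matrix.mul_apply, Fintype.sum_sum_type] at hab
  have e1 : ∀ l : Fin m, ((shifted X z - shifted (Function.update X k 0) z) * resolvent X z)
      (Sum.inl l) b = if l = k then ∑ i, col X k i * resolvent X z (Sum.inr i) b else 0 := by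
    intro l
    rw [Matrix.mul_apply, Fintype.sum_sum_type]
    simp only [Matrix.sub_apply, shifted_inl_inl, shifted_inl_inr, sub_self, zero_mul,
      Finset.sum_const_zero, zero_add]
    split_ifs with hl
    · subst hl; simp [col_update_self]
    · simp [col_update_of_ne X hl]
  have e2 : ∀ i : Fin n, ((shifted X z - shifted (Function.update X k 0) z) * resolvent X z)
      (Sum.inr i) b = col X k i * resolvent X z (Sum.inl k) b := by
    intro i
    rw [Matrix.mul_apply, Fintype.sum_sum_type]
    simp only [Matrix.sub_apply, shifted_inr_inl, shifted_inr_inr, sub_self, zero_mul,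
      Finset.sum_const_zero, add_zero]
    rw [Finset.sum_eq_single k]
    · simp [col_update_self]
    · intro l _ hl; simp [col_update_of_ne X hl]
    · simp
  simp only [e1, e2, mul_ite, mul_zero, Finset.sum_ite_eq', Finset.mem_univ, if_true] at hab
  rw [Finset.sum_mul]
  have e3 : ∑ i, minor X k z a (Sum.inr i) * col X k i * resolvent X z (Sum.inl k) b =
      ∑ i, minor X k z a (Sum.inr i) * (col X k i * resolvent X z (Sum.inl k) b) :=
    Finset.sum_congr rfl fun i _ => mul_assoc _ _ _
  rw [e3]
  linear_combination -hab

theorem minor_inl_self_inr (hz : z.im ≠ 0) (k : Fin m) (i : Fin n) :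
    minor X k z (Sum.inl k) (Sum.inr i) = 0 := by
  have hz0 : z ≠ 0 := fun h => hz (by simp [h])
  simpa [hz0] using minor_inl_self X hz k (Sum.inr i)

theorem minor_inr_inl_self (hz : z.im ≠ 0) (k : Fin m) (i : Fin n) :
    minor X k z (Sum.inr i) (Sum.inl k) = 0 := by
  rw [minor, resolvent_symm, ← minor]; exact minor_inl_self_inr X hz k i

theorem resolvent_inr_inl (hz : z.im ≠ 0) (k : Fin m) (i : Fin n) :
    resolvent X z (Sum.inr i) (Sum.inl k) =
      -(minorVec X k z i * resolvent X z (Sum.inl k) (Sum.inl k)) := by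
  rw [resolvent_eq_minor X hz k, minor_inr_inl_self X hz, minorVec]
  ring

/-- Schur complement formula. -/
theorem resolvent_inl_mul (hz : z.im ≠ 0) (k : Fin m) :
    resolvent X z (Sum.inl k) (Sum.inl k) * (z + minorForm X k z) = -1 := by
  have h := resolvent_eq_minor X hz k (Sum.inl k) (Sum.inl k)
  have h0 := minor_inl_self X hz k (Sum.inl k)
  simp only [minor_inl_self_inr X hz, zero_mul, Finset.sum_const_zero, sub_zero] at h
  have h1 : ∑ i, col X k i * resolvent X z (Sum.inr i) (Sum.inl k) =
      -(minorForm X k z * resolvent X z (Sum.inl k) (Sum.inl k)) := by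
    rw [minorForm, Finset.sum_mul, ← Finset.sum_neg_distrib]
    exact Finset.sum_congr rfl fun i _ => by rw [resolvent_inr_inl X hz]; ring
  rw [h1] at h
  simp only [if_true] at h0
  linear_combination z * h + (1 + minorForm X k z * resolvent X z (Sum.inl k) (Sum.inl k)) * h0

theorem resolvent_inr_inr (hz : z.im ≠ 0) (k : Fin m) (i j : Fin n) :
    resolvent X z (Sum.inr i) (Sum.inr j) = minor X k z (Sum.inr i) (Sum.inr j)
      + resolvent X z (Sum.inl k) (Sum.inl k) * (minorVec X k z i * minorVec X k z j) := by
  rw [resolvent_eq_minor X hz k, minor_inr_inl_self X hz, resolvent_symm X (Sum.inl k),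
    resolvent_inr_inl X hz, ← minorVec]
  ring

theorem resolvent_inl_mul_sum_le (hz : z.im ≠ 0) (k : Fin m) :
    ‖resolvent X z (Sum.inl k) (Sum.inl k)‖ * ∑ i, ‖minorVec X k z i‖ ^ 2 ≤ 1 / |z.im| := by
  have hv : 0 < |z.im| := abs_pos.2 hz
  have h := abs_im_mul_sum_le X hz (Sum.inl k)
  rw [Fintype.sum_sum_type] at h
  simp only [resolvent_inr_inl X hz, norm_neg, norm_mul, mul_pow] at h
  rw [← Finset.sum_mul] at h
  set r := ‖resolvent X z (Sum.inl k) (Sum.inl k)‖ with hr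
  have hr0 : 0 < r := by
    rw [hr, norm_pos_iff]
    intro h0
    have := resolvent_inl_mul X hz k
    rw [h0] at this
    simp at this
  have h1 : 0 ≤ ∑ l, ‖resolvent X z (Sum.inl l) (Sum.inl k)‖ ^ 2 :=
    Finset.sum_nonneg fun _ _ => sq_nonneg _
  rw [le_div_iff₀ hv]
  generalize ∑ i, ‖minorVec X k z i‖ ^ 2 = W at h ⊢
  have h2 : |z.im| * (W * r ^ 2) ≤ r := by
    rw [mul_add] at h
    linarith [mul_nonneg hv.le h1]
  have h3 : r * (r * W * |z.im|) ≤ r * 1 := by linarith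
  exact le_of_mul_le_mul_left h3 hr0

/-- The normalized trace of the lower block of the resolvent. -/
def ntr (z : ℂ) : ℂ := (∑ i, resolvent X z (Sum.inr i) (Sum.inr i)) / n

theorem norm_trace_sub_minor_le (hz : z.im ≠ 0) (k : Fin m) :
    ‖∑ i, resolvent X z (Sum.inr i) (Sum.inr i) - ∑ i, minor X k z (Sum.inr i) (Sum.inr i)‖
      ≤ 1 / |z.im| := by
  refine le_trans ?_ (resolvent_inl_mul_sum_le X hz k)
  rw [← Finset.sum_sub_distrib, Finset.mul_sum]
  refine (norm_sum_le _ _).trans (Finset.sum_le_sum fun i _ => ?_)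
  rw [resolvent_inr_inr X hz k, add_sub_cancel_left, norm_mul, norm_mul, pow_two]

/-- The two diagonal blocks have the same trace up to the contribution of the kernel. -/
theorem trace_relation (hz : z.im ≠ 0) :
    z * (∑ l, resolvent X z (Sum.inl l) (Sum.inl l) - ∑ i, resolvent X z (Sum.inr i) (Sum.inr i))
      = n - m := by
  have h1 : ∀ l : Fin m, ∑ i, col X l i * resolvent X z (Sum.inr i) (Sum.inl l) =
      1 + z * resolvent X z (Sum.inl l) (Sum.inl l) := fun l => by
    have := congrFun (congrFun (shifted_mul_resolvent X hz) (Sum.inl l)) (Sum.inl l)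
    rw [Matrix.mul_apply, Fintype.sum_sum_type, Matrix.one_apply_eq] at this
    simp only [shifted_inl_inl, shifted_inl_inr, ite_mul, zero_mul, Finset.sum_ite_eq,
      Finset.mem_univ, if_true] at this
    linear_combination this
  have h2 : ∀ i : Fin n, ∑ l, col X l i * resolvent X z (Sum.inr i) (Sum.inl l) =
      1 + z * resolvent X z (Sum.inr i) (Sum.inr i) := fun i => by
    have := congrFun (congrFun (shifted_mul_resolvent X hz) (Sum.inr i)) (Sum.inr i)
    rw [Matrix.mul_apply, Fintype.sum_sum_type, Matrix.one_apply_eq] at this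
    simp only [shifted_inr_inl, shifted_inr_inr, ite_mul, zero_mul, Finset.sum_ite_eq,
      Finset.mem_univ, if_true, resolvent_symm X (Sum.inl _)] at this
    linear_combination this
  have h3 := Finset.sum_comm (s := Finset.univ) (t := Finset.univ)
    (f := fun (l : Fin m) (i : Fin n) => col X l i * resolvent X z (Sum.inr i) (Sum.inl l))
  simp only [h1, h2, Finset.sum_add_distrib, ← Finset.mul_sum, Finset.sum_const, Finset.card_univ,
    Fintype.card_fin, nsmul_eq_mul, mul_one] at h3
  linear_combination h3

theorem ntr_im_mul_nonneg (hz : z.im ≠ 0) : 0 ≤ (ntr X z).im * z.im := by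
  rw [ntr, Complex.div_natCast_im, Complex.im_sum, div_mul_eq_mul_div, Finset.sum_mul]
  exact div_nonneg (Finset.sum_nonneg fun i _ => im_resolvent_mul_nonneg X hz _) (by positivity)

theorem norm_ntr_le (hz : z.im ≠ 0) : ‖ntr X z‖ ≤ 1 / |z.im| := by
  rw [ntr, norm_div, Complex.norm_natCast]
  refine div_le_of_le_mul₀ (by positivity) (by positivity) ?_
  refine (norm_sum_le _ _).trans ((Finset.sum_le_sum fun i _ =>
    norm_resolvent_diag_le X hz (Sum.inr i)).trans ?_)
  simp [mul_comm]

/-- A point in the same half-plane as `z` pushes `z` further away from the real axis. -/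
theorem abs_im_le_norm_add {z w : ℂ} (hw : 0 ≤ w.im * z.im) :
    |z.im| ≤ ‖z + w‖ := by
  refine le_trans ?_ (Complex.abs_im_le_norm _)
  rw [Complex.add_im]
  refine sq_le_sq.1 ?_
  nlinarith [sq_nonneg w.im]

end Resolvent

/-! ### The self-consistent equation and its stability -/

theorem s1_equation (c : ℝ) {z : ℂ} (hz0 : z ≠ 0) :
    z * s1 c z ^ 2 + (z ^ 2 - c + 1) * s1 c z + z = 0 := by
  have h := sqrtDisc_sq c hz0
  unfold s1
  field_simp
  linear_combination h

theorem s1_mul (c : ℝ) {z : ℂ} (hz0 : z ≠ 0) :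
    s1 c z * (z + s1 c z + (1 - c) / z) = -1 := by
  have h := s1_equation c hz0
  field_simp
  linear_combination h

/-- The limits of the two blocks are linked in the same way as the entries in the Schur complement
formula. -/
theorem s2_mul {c : ℝ} (hc : c ≠ 0) {z : ℂ} (hz0 : z ≠ 0) :
    s2 c z * (z + s1 c z) = -1 := by
  have hc' : (c : ℂ) ≠ 0 := by exact_mod_cast hc
  have h := s1_equation c hz0
  have h2 : s2 c z = (s1 c z + (1 - c) / z) / c := by
    unfold s1 s2
    field_simp
    ring
  rw [h2]
  field_simp
  linear_combination h

section

variable {c : ℝ} {z : ℂ}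

theorem one_sub_div_im_mul_nonneg (hc : 1 ≤ c) (z : ℂ) : 0 ≤ ((1 - c) / z : ℂ).im * z.im := by
  have h : ((1 - c) / z : ℂ) = ((1 - c : ℝ) : ℂ) * z⁻¹ := by push_cast; ring
  rw [h, Complex.im_ofReal_mul, Complex.inv_im]
  have : (1 - c) * (-z.im / Complex.normSq z) * z.im = (c - 1) * (z.im ^ 2 / Complex.normSq z) := by
    ring
  rw [this]
  exact mul_nonneg (by linarith) (div_nonneg (sq_nonneg _) (Complex.normSq_nonneg z))

theorem abs_im_le_norm_s1_add (hc : 1 ≤ c) (hz : z.im ≠ 0) {w : ℂ} (hw : 0 ≤ w.im * z.im) :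
    |z.im| ≤ ‖w + (z + s1 c z + (1 - c) / z)‖ := by
  have h1 := s1_im_mul_im_pos hc hz
  have h2 := one_sub_div_im_mul_nonneg hc z
  have := abs_im_le_norm_add (z := z) (w := w + s1 c z + (1 - c) / z) (by
    simp only [Complex.add_im, add_mul]; linarith)
  refine this.trans (le_of_eq ?_)
  congr 1; ring

theorem norm_s1_le (hc : 1 ≤ c) (hz : z.im ≠ 0) : ‖s1 c z‖ ≤ 1 / |z.im| := by
  have hz0 : z ≠ 0 := fun h => hz (by simp [h])
  have hv : 0 < |z.im| := abs_pos.2 hz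
  have h1 := congrArg norm (s1_mul c hz0)
  have h2 := abs_im_le_norm_s1_add hc hz (w := 0) (by simp)
  rw [norm_mul, norm_neg, norm_one] at h1
  rw [zero_add] at h2
  rw [le_div_iff₀ hv, ← h1]
  gcongr

theorem norm_s2_le (hc : 1 ≤ c) (hz : z.im ≠ 0) : ‖s2 c z‖ ≤ 1 / |z.im| := by
  have hz0 : z ≠ 0 := fun h => hz (by simp [h])
  have hv : 0 < |z.im| := abs_pos.2 hz
  have h1 := congrArg norm (s2_mul (c := c) (by linarith) hz0)
  have h2 := abs_im_le_norm_add (s1_im_mul_im_pos hc hz).le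
  rw [norm_mul, norm_neg, norm_one] at h1
  rw [le_div_iff₀ hv, ← h1]
  gcongr

variable {n m : ℕ} (X : Fin m → EuclideanSpace ℝ (Fin n))

/-- The exact equation for the normalized trace, obtained by summing the Schur complement formula
over the columns: it is the equation of `s1` perturbed by the deviations of the quadratic forms. -/
theorem sum_minorForm_equation (hn : n ≠ 0) (hz : z.im ≠ 0) :
    (z + ntr X z) * (ntr X z + (1 - m / n) / z) + m / n =
      (∑ k, resolvent X z (Sum.inl k) (Sum.inl k) * (ntr X z - minorForm X k z)) / n := by
  have hz0 : z ≠ 0 := fun h => hz (by simp [h])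
  have hn' : (n : ℂ) ≠ 0 := by exact_mod_cast hn
  have ht := trace_relation X hz
  have h1 : ∑ i, resolvent X z (Sum.inr i) (Sum.inr i) = n * ntr X z := by
    rw [ntr]; field_simp
  have h2 : ∑ k, resolvent X z (Sum.inl k) (Sum.inl k) * (ntr X z - minorForm X k z) =
      (z + ntr X z) * ∑ k, resolvent X z (Sum.inl k) (Sum.inl k) + m := by
    have : ∀ k, resolvent X z (Sum.inl k) (Sum.inl k) * (ntr X z - minorForm X k z) =
        (z + ntr X z) * resolvent X z (Sum.inl k) (Sum.inl k) + 1 := fun k => by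
      linear_combination -(resolvent_inl_mul X hz k)
    simp only [this, Finset.sum_add_distrib, ← Finset.mul_sum]
    simp
  rw [h2]
  rw [h1] at ht
  generalize ∑ k, resolvent X z (Sum.inl k) (Sum.inl k) = T at ht ⊢
  field_simp
  linear_combination -(z + ntr X z) * ht

/-- Stability: the quadratic satisfied by `s1` has roots `s1` and `1 / s1`, and `1 / s1` lies in
the half-plane opposite to `z`, at distance at least `|Im z|` from the other one. -/
theorem norm_ntr_sub_s1_le (hc : 1 ≤ c) (hn : n ≠ 0) (hz : z.im ≠ 0) :
    ‖ntr X z - s1 c z‖ ≤ (∑ k, ‖ntr X z - minorForm X k z‖) / n / |z.im| ^ 2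
      + |(m : ℝ) / n - c| / |z.im| ^ 3 := by
  have hz0 : z ≠ 0 := fun h => hz (by simp [h])
  have hv : 0 < |z.im| := abs_pos.2 hz
  set g := ntr X z with hg
  set s := s1 c z with hs
  have he := sum_minorForm_equation X hn hz
  rw [← hg] at he
  have hs1 := s1_mul c hz0
  rw [← hs] at hs1
  have key : (g - s) * (g + (z + s + (1 - c) / z)) =
      (∑ k, resolvent X z (Sum.inl k) (Sum.inl k) * (g - minorForm X k z)) / n
        + ((m / n - c : ℝ) : ℂ) * (g / z) := by
    rw [← he]
    push_cast
    field_simp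
    field_simp at hs1
    linear_combination -(n : ℂ) * hs1
  have hb1 : ‖(∑ k, resolvent X z (Sum.inl k) (Sum.inl k) * (g - minorForm X k z)) / n‖ ≤
      (∑ k, ‖g - minorForm X k z‖) / n / |z.im| := by
    rw [norm_div, Complex.norm_natCast, div_right_comm, Finset.sum_div]
    gcongr
    refine (norm_sum_le _ _).trans (Finset.sum_le_sum fun k _ => ?_)
    rw [norm_mul, mul_comm, div_eq_mul_one_div ‖g - minorForm X k z‖]
    gcongr
    exact norm_resolvent_diag_le X hz _
  have hb2 : ‖((m / n - c : ℝ) : ℂ) * (g / z)‖ ≤ |(m : ℝ) / n - c| / |z.im| ^ 2 := by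
    rw [norm_mul, Complex.norm_real, Real.norm_eq_abs, div_eq_mul_one_div (|(m : ℝ) / n - c|),
      norm_div]
    refine mul_le_mul_of_nonneg_left ?_ (abs_nonneg _)
    rw [pow_two, ← div_div]
    exact div_le_div₀ (by positivity) (norm_ntr_le X hz) hv (Complex.abs_im_le_norm z)
  have hd := abs_im_le_norm_s1_add hc hz (ntr_im_mul_nonneg X hz)
  rw [← hg, ← hs] at hd
  have h1 : ‖g - s‖ * |z.im| ≤ (∑ k, ‖g - minorForm X k z‖) / n / |z.im|
      + |(m : ℝ) / n - c| / |z.im| ^ 2 := by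
    calc _ ≤ ‖g - s‖ * ‖g + (z + s + (1 - c) / z)‖ := by gcongr
      _ = ‖(g - s) * (g + (z + s + (1 - c) / z))‖ := (norm_mul _ _).symm
      _ ≤ _ := by
        rw [key]
        exact (norm_add_le _ _).trans (add_le_add hb1 hb2)
  rw [← le_div_iff₀ hv] at h1
  refine h1.trans (le_of_eq ?_)
  field_simp

theorem norm_resolvent_inl_sub_s2_le (hc : 1 ≤ c) (hz : z.im ≠ 0) (k : Fin m) :
    ‖resolvent X z (Sum.inl k) (Sum.inl k) - s2 c z‖ ≤
      (‖ntr X z - minorForm X k z‖ + ‖ntr X z - s1 c z‖) / |z.im| ^ 2 := by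
  have hz0 : z ≠ 0 := fun h => hz (by simp [h])
  have hv : 0 < |z.im| := abs_pos.2 hz
  have h1 := resolvent_inl_mul X hz k
  have h2 := s2_mul (c := c) (by linarith) hz0
  have key : resolvent X z (Sum.inl k) (Sum.inl k) - s2 c z =
      resolvent X z (Sum.inl k) (Sum.inl k) * s2 c z * (minorForm X k z - s1 c z) := by
    linear_combination resolvent X z (Sum.inl k) (Sum.inl k) * h2 - s2 c z * h1
  have h3 : ‖minorForm X k z - s1 c z‖ ≤
      ‖ntr X z - minorForm X k z‖ + ‖ntr X z - s1 c z‖ := by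
    have : minorForm X k z - s1 c z = (ntr X z - s1 c z) - (ntr X z - minorForm X k z) := by ring
    rw [this, add_comm]
    exact norm_sub_le _ _
  rw [key, norm_mul, norm_mul, div_eq_mul_one_div, mul_comm]
  have h4 : ‖resolvent X z (Sum.inl k) (Sum.inl k)‖ * ‖s2 c z‖ ≤ 1 / |z.im| ^ 2 := by
    rw [pow_two, ← one_div_mul_one_div]
    exact mul_le_mul (norm_resolvent_diag_le X hz _) (norm_s2_le hc hz) (norm_nonneg _)
      (by positivity)
  exact mul_le_mul h3 h4 (by positivity) (by positivity)

end

/-! ### Product measures: resampling one coordinate, and the Efron–Stein inequality -/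

section Product

variable {ι E : Type*} [DecidableEq ι] [MeasurableSpace E] (γ : Measure E)
  [IsProbabilityMeasure γ]

/-- Average over the `k`-th coordinate. -/
def avg (k : ι) (f : (ι → E) → ℝ) (x : ι → E) : ℝ := ∫ y, f (Function.update x k y) ∂γ

variable {γ}

theorem measurable_avg (k : ι) {f : (ι → E) → ℝ} (hf : Measurable f) : Measurable (avg γ k f) :=
  (StronglyMeasurable.integral_prod_right
    (f := fun (x : ι → E) (y : E) => f (Function.update x k y))
    (hf.comp measurable_update').stronglyMeasurable).measurable

theorem abs_avg_le (k : ι) {f : (ι → E) → ℝ} {M : ℝ} (hM : ∀ x, |f x| ≤ M) (x : ι → E) :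
    |avg γ k f x| ≤ M := by
  have := norm_integral_le_of_norm_le_const (μ := γ) (f := fun y => f (Function.update x k y))
    (ae_of_all _ fun y => hM _)
  simpa [avg] using this

theorem integrable_of_abs_le {Ω : Type*} [MeasurableSpace Ω] {P : Measure Ω} [IsFiniteMeasure P]
    {f : Ω → ℝ} (hf : Measurable f) {M : ℝ} (hM : ∀ x, |f x| ≤ M) : Integrable f P :=
  Integrable.of_bound hf.aestronglyMeasurable M (ae_of_all _ hM)

theorem integrable_sub_sq_of_abs_le {Ω : Type*} [MeasurableSpace Ω] {P : Measure Ω}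
    [IsFiniteMeasure P] {f g : Ω → ℝ} (hf : Measurable f) (hg : Measurable g) {M : ℝ}
    (hM : ∀ x, |f x| ≤ M) (hM' : ∀ x, |g x| ≤ M) : Integrable (fun x => (f x - g x) ^ 2) P := by
  refine integrable_of_abs_le (M := (2 * M) ^ 2) ((hf.sub hg).pow_const 2) fun x => ?_
  rw [abs_pow]
  refine pow_le_pow_left₀ (abs_nonneg _) ((abs_sub _ _).trans ?_) 2
  linarith [hM x, hM' x]

/-- Replacing a comparison function `h` by its mean costs at most the variance of `f`. -/
theorem integral_sub_integral_sq_le {f h : E → ℝ} {M : ℝ} (hf : Measurable f) (hh : Measurable h)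
    (hfM : ∀ y, |f y| ≤ M) (hhM : ∀ y, |h y| ≤ M) (a : ℝ) :
    ∫ y, (f y - ∫ y', h y' ∂γ) ^ 2 ∂γ ≤ ∫ y, (f y - a) ^ 2 ∂γ + ∫ y, (f y - h y) ^ 2 ∂γ := by
  set b := ∫ y', h y' ∂γ with hb
  have fi : Integrable f γ := integrable_of_abs_le hf hfM
  have hi : Integrable h γ := integrable_of_abs_le hh hhM
  have fi2 : Integrable (fun y => f y ^ 2) γ :=
    integrable_of_abs_le (M := M ^ 2) (hf.pow_const 2) fun y => by
      rw [abs_pow]; exact pow_le_pow_left₀ (abs_nonneg _) (hfM y) 2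
  have ex : ∀ c : ℝ, ∫ y, (f y - c) ^ 2 ∂γ = ∫ y, f y ^ 2 ∂γ - 2 * c * ∫ y, f y ∂γ + c ^ 2 := by
    intro c
    have : ∀ y, (f y - c) ^ 2 = f y ^ 2 - 2 * c * f y + c ^ 2 := fun y => by ring
    simp_rw [this]
    have i1 : Integrable (fun y => f y ^ 2 - 2 * c * f y) γ := fi2.sub (fi.const_mul _)
    rw [integral_add i1 (integrable_const _), integral_sub fi2 (fi.const_mul _),
      integral_const_mul]
    simp
  have di : Integrable (fun y => f y - h y) γ := fi.sub hi
  have di2 := integrable_sub_sq_of_abs_le (P := γ) hf hh hfM hhM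
  have jensen : (∫ y, f y ∂γ - b) ^ 2 ≤ ∫ y, (f y - h y) ^ 2 ∂γ := by
    rw [hb, ← integral_sub fi hi]
    set t := ∫ y, (f y - h y) ∂γ with ht
    have h1 : ∫ y, (2 * t * (f y - h y) - t ^ 2) ∂γ ≤ ∫ y, (f y - h y) ^ 2 ∂γ :=
      integral_mono ((di.const_mul _).sub (integrable_const _)) di2 fun y => by
        nlinarith [sq_nonneg (f y - h y - t)]
    rw [integral_sub (di.const_mul _) (integrable_const _), integral_const_mul, ← ht] at h1
    simp only [integral_const, probReal_univ, one_smul] at h1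
    linarith
  rw [ex, ex]
  nlinarith [sq_nonneg (∫ y, f y ∂γ - a)]

variable [Fintype ι]

theorem measurePreserving_update (γ : Measure E) [IsProbabilityMeasure γ] (k : ι) :
    MeasurePreserving (fun p : (ι → E) × E => Function.update p.1 k p.2)
      ((Measure.pi fun _ : ι => γ).prod γ) (Measure.pi fun _ : ι => γ) := by
  refine ⟨measurable_update', ?_⟩
  refine (Measure.pi_eq fun s hs => ?_).symm
  rw [Measure.map_apply measurable_update' (MeasurableSet.univ_pi hs)]
  have : (fun p : (ι → E) × E => Function.update p.1 k p.2) ⁻¹' Set.univ.pi s =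
      (Set.univ.pi (Function.update s k Set.univ)) ×ˢ s k := by
    ext ⟨x, y⟩
    simp only [Set.mem_preimage, Set.mem_pi, Set.mem_univ, true_implies, Set.mem_prod]
    constructor
    · intro h
      refine ⟨fun i => ?_, by simpa using h k⟩
      rcases eq_or_ne i k with rfl | hi
      · simp
      · simpa [hi] using h i
    · rintro ⟨h1, h2⟩ i
      rcases eq_or_ne i k with rfl | hi
      · simpa using h2
      · simpa [hi] using h1 i
  rw [this, Measure.prod_prod, Measure.pi_pi, mul_comm,
    ← Finset.mul_prod_erase _ (fun i => γ (s i)) (Finset.mem_univ k),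
    ← Finset.mul_prod_erase _ _ (Finset.mem_univ k)]
  simp only [Function.update_self, measure_univ, one_mul]
  congr 1
  exact Finset.prod_congr rfl fun i hi => by rw [Function.update_of_ne (Finset.ne_of_mem_erase hi)]

/-- A bound on the average over the `k`-th coordinate, uniform in the other coordinates, can be
integrated. -/
theorem integral_pi_le_of_update {F G : (ι → E) → ℝ} (hF : Measurable F) (h0 : ∀ x, 0 ≤ F x)
    (k : ι) (hG : Integrable G (Measure.pi fun _ : ι => γ))
    (h : ∀ x, Integrable (fun y => F (Function.update x k y)) γ ∧
      ∫ y, F (Function.update x k y) ∂γ ≤ G x) :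
    Integrable F (Measure.pi fun _ : ι => γ) ∧
      ∫ x, F x ∂(Measure.pi fun _ : ι => γ) ≤ ∫ x, G x ∂(Measure.pi fun _ : ι => γ) := by
  have hmp := measurePreserving_update γ k
  have hm : Measurable (fun p : (ι → E) × E => F (Function.update p.1 k p.2)) :=
    hF.comp measurable_update'
  have hi2 : Integrable (fun p : (ι → E) × E => F (Function.update p.1 k p.2))
      ((Measure.pi fun _ : ι => γ).prod γ) := by
    rw [integrable_prod_iff hm.aestronglyMeasurable]
    refine ⟨ae_of_all _ fun x => (h x).1, hG.mono'
      (hm.norm.stronglyMeasurable.integral_prod_right).aestronglyMeasurable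
      (ae_of_all _ fun x => ?_)⟩
    simp only [Real.norm_of_nonneg (h0 _)]
    rw [Real.norm_of_nonneg (integral_nonneg fun y => h0 _)]
    exact (h x).2
  have hi : Integrable F (Measure.pi fun _ : ι => γ) :=
    (hmp.integrable_comp hF.aestronglyMeasurable).1 hi2
  refine ⟨hi, ?_⟩
  rw [← hmp.map_eq, integral_map measurable_update'.aemeasurable hF.aestronglyMeasurable,
    integral_prod _ hi2, hmp.map_eq]
  exact integral_mono hi2.integral_prod_left hG fun x => (h x).2

/-- One step of the Efron–Stein inequality: averaging the comparison function `h` over the `k`-th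
coordinate costs the distance of `f` to a function `g` that does not depend on it. -/
theorem integral_sub_avg_sq_le (k : ι) {f g h : (ι → E) → ℝ} {M : ℝ} (hf : Measurable f)
    (hg : Measurable g) (hh : Measurable h) (hfM : ∀ y, |f y| ≤ M) (hgM : ∀ y, |g y| ≤ M)
    (hhM : ∀ y, |h y| ≤ M) (hgk : ∀ x y, g (Function.update x k y) = g x) :
    ∫ x, (f x - avg γ k h x) ^ 2 ∂(Measure.pi fun _ : ι => γ) ≤
      ∫ x, (f x - g x) ^ 2 ∂(Measure.pi fun _ : ι => γ)
        + ∫ x, (f x - h x) ^ 2 ∂(Measure.pi fun _ : ι => γ) := by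
  have hmp := measurePreserving_update γ k
  have hu : Measurable fun p : (ι → E) × E => Function.update p.1 k p.2 := measurable_update'
  have ex : ∀ w : (ι → E) → ℝ, Measurable w → (∀ x, |w x| ≤ M) →
      ∫ x, (f x - w x) ^ 2 ∂(Measure.pi fun _ : ι => γ) =
      ∫ x, ∫ y, (f (Function.update x k y) - w (Function.update x k y)) ^ 2 ∂γ
        ∂(Measure.pi fun _ : ι => γ) ∧ Integrable (fun x => ∫ y, (f (Function.update x k y)
          - w (Function.update x k y)) ^ 2 ∂γ) (Measure.pi fun _ : ι => γ) := by
    intro w hw hwM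
    have hi : Integrable (fun p : (ι → E) × E => (f (Function.update p.1 k p.2)
        - w (Function.update p.1 k p.2)) ^ 2) ((Measure.pi fun _ : ι => γ).prod γ) :=
      integrable_sub_sq_of_abs_le (hf.comp hu) (hw.comp hu) (fun _ => hfM _) (fun _ => hwM _)
    refine ⟨?_, hi.integral_prod_left⟩
    have hm : Measurable fun x => (f x - w x) ^ 2 := (hf.sub hw).pow_const 2
    conv_lhs => rw [← hmp.map_eq]
    rw [integral_map hu.aemeasurable hm.aestronglyMeasurable,
      integral_prod _ hi]
  obtain ⟨e1, i1⟩ := ex _ (measurable_avg (γ := γ) k hh) (abs_avg_le k hhM)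
  obtain ⟨e2, i2⟩ := ex g hg hgM
  obtain ⟨e3, i3⟩ := ex h hh hhM
  rw [e1, e2, e3, ← integral_add i2 i3]
  refine integral_mono i1 (i2.add i3) fun x => ?_
  simp only [hgk, avg, Function.update_idem]
  exact integral_sub_integral_sq_le (hf.comp (measurable_update x)) (hh.comp (measurable_update x))
    (fun _ => hfM _) (fun _ => hhM _) (g x)

/-- The Efron–Stein inequality, with an unspecified constant `b` in place of the mean and with `g k`
an arbitrary function independent of the `k`-th coordinate. -/
theorem efron_stein {f : (ι → E) → ℝ} {g : ι → (ι → E) → ℝ} {M : ℝ} (hf : Measurable f)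
    (hg : ∀ k, Measurable (g k)) (hfM : ∀ y, |f y| ≤ M) (hgM : ∀ k y, |g k y| ≤ M)
    (hgk : ∀ k x y, g k (Function.update x k y) = g k x) :
    ∃ b : ℝ, |b| ≤ M ∧ ∫ x, (f x - b) ^ 2 ∂(Measure.pi fun _ : ι => γ) ≤
      ∑ k, ∫ x, (f x - g k x) ^ 2 ∂(Measure.pi fun _ : ι => γ) := by
  -- the coordinates are averaged out one by one
  have key : ∀ s : Finset ι, ∃ h : (ι → E) → ℝ, Measurable h ∧ (∀ x, |h x| ≤ M) ∧
      (∀ k ∈ s, ∀ x y, h (Function.update x k y) = h x) ∧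
      ∫ x, (f x - h x) ^ 2 ∂(Measure.pi fun _ : ι => γ) ≤
        ∑ k ∈ s, ∫ x, (f x - g k x) ^ 2 ∂(Measure.pi fun _ : ι => γ) := by
    intro s
    induction s using Finset.induction_on with
    | empty => exact ⟨f, hf, hfM, by simp, by simp⟩
    | insert k s hk ih =>
      obtain ⟨h, hh, hhM, hhs, hle⟩ := ih
      refine ⟨avg γ k h, measurable_avg k hh, abs_avg_le k hhM, ?_, ?_⟩
      · intro j hj x y
        rcases eq_or_ne j k with rfl | hjk
        · simp [avg]
        · have hjs : j ∈ s := (Finset.mem_insert.1 hj).resolve_left hjk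
          simp only [avg]
          congr 1
          funext y'
          rw [Function.update_comm hjk, hhs j hjs]
      · rw [Finset.sum_insert hk]
        exact (integral_sub_avg_sq_le k hf (hg k) hh hfM (hgM k) hhM (hgk k)).trans
          (add_le_add le_rfl hle)
  obtain ⟨h, hh, hhM, hhs, hle⟩ := key Finset.univ
  have hne : Nonempty (ι → E) := by
    have : Nonempty E := nonempty_of_isProbabilityMeasure γ
    infer_instance
  have hconst : ∀ (s : Finset ι) (x x' : ι → E), h (s.piecewise x' x) = h x := by
    intro s x x'
    induction s using Finset.induction_on with
    | empty => simp
    | insert k s hk ih => rw [Finset.piecewise_insert, hhs k (Finset.mem_univ k), ih]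
  obtain ⟨x₀⟩ := hne
  refine ⟨h x₀, hhM x₀, ?_⟩
  have : ∀ x, h x = h x₀ := fun x => by
    have := hconst Finset.univ x x₀
    rw [Finset.piecewise_univ] at this
    exact this.symm
  simpa only [this] using hle

theorem efron_stein_complex {f : (ι → E) → ℂ} {g : ι → (ι → E) → ℂ} {M : ℝ} (hf : Measurable f)
    (hg : ∀ k, Measurable (g k)) (hfM : ∀ y, ‖f y‖ ≤ M) (hgM : ∀ k y, ‖g k y‖ ≤ M)
    (hgk : ∀ k x y, g k (Function.update x k y) = g k x) :
    ∃ b : ℂ, ∫ x, ‖f x - b‖ ^ 2 ∂(Measure.pi fun _ : ι => γ) ≤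
      ∑ k, ∫ x, ‖f x - g k x‖ ^ 2 ∂(Measure.pi fun _ : ι => γ) := by
  have fr : Measurable fun x => (f x).re := Complex.measurable_re.comp hf
  have fi : Measurable fun x => (f x).im := Complex.measurable_im.comp hf
  have gr : ∀ k, Measurable fun x => (g k x).re := fun k => Complex.measurable_re.comp (hg k)
  have gi : ∀ k, Measurable fun x => (g k x).im := fun k => Complex.measurable_im.comp (hg k)
  have frM : ∀ x, |(f x).re| ≤ M := fun x => (Complex.abs_re_le_norm _).trans (hfM x)
  have fiM : ∀ x, |(f x).im| ≤ M := fun x => (Complex.abs_im_le_norm _).trans (hfM x)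
  have grM : ∀ k x, |(g k x).re| ≤ M := fun k x => (Complex.abs_re_le_norm _).trans (hgM k x)
  have giM : ∀ k x, |(g k x).im| ≤ M := fun k x => (Complex.abs_im_le_norm _).trans (hgM k x)
  obtain ⟨b₁, hb₁, h1⟩ := efron_stein (γ := γ) (g := fun k x => (g k x).re) fr gr frM grM
    (fun k x y => by simp [hgk])
  obtain ⟨b₂, hb₂, h2⟩ := efron_stein (γ := γ) (g := fun k x => (g k x).im) fi gi fiM giM
    (fun k x y => by simp [hgk])
  refine ⟨⟨b₁, b₂⟩, ?_⟩
  have hn : ∀ w w' : ℂ, ‖w - w'‖ ^ 2 = (w.re - w'.re) ^ 2 + (w.im - w'.im) ^ 2 := fun w w' => by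
    rw [← Complex.normSq_eq_norm_sq, Complex.normSq_apply, Complex.sub_re, Complex.sub_im]; ring
  simp_rw [hn]
  rw [integral_add (integrable_sub_sq_of_abs_le fr measurable_const frM fun _ => hb₁)
    (integrable_sub_sq_of_abs_le fi measurable_const fiM fun _ => hb₂)]
  refine (add_le_add h1 h2).trans (le_of_eq ?_)
  rw [← Finset.sum_add_distrib]
  exact Finset.sum_congr rfl fun k _ => (integral_add
    (integrable_sub_sq_of_abs_le fr (gr k) frM (grM k))
    (integrable_sub_sq_of_abs_le fi (gi k) fiM (giM k))).symm

end Product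

/-! ### Measurability and row symmetry of the resolvent -/

section

variable {n m : ℕ} {z : ℂ}

theorem continuous_resolvent (hz : z.im ≠ 0) (a b : Fin m ⊕ Fin n) :
    Continuous fun X : Fin m → EuclideanSpace ℝ (Fin n) => resolvent X z a b := by
  have hs : Continuous fun X : Fin m → EuclideanSpace ℝ (Fin n) => shifted X z := by
    refine continuous_matrix fun i j => ?_
    rcases i with i | i <;> rcases j with j | j
    · simp only [shifted_inl_inl]; fun_prop
    · simp only [shifted_inl_inr, col]; fun_prop
    · simp only [shifted_inr_inl, col]; fun_prop
    · simp only [shifted_inr_inr]; fun_prop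
  have h : (fun X : Fin m → EuclideanSpace ℝ (Fin n) => resolvent X z) =
      fun X => ((shifted X z).det)⁻¹ • (shifted X z).adjugate := by
    funext X
    rw [resolvent_eq, Matrix.inv_def, Ring.inverse_eq_inv']
  have hc : Continuous fun X : Fin m → EuclideanSpace ℝ (Fin n) => resolvent X z := by
    rw [h]
    exact (hs.matrix_det.inv₀ fun X => det_shifted_ne_zero X hz).smul hs.matrix_adjugate
  exact hc.matrix_elem a b

theorem continuous_minor (hz : z.im ≠ 0) (k : Fin m) (a b : Fin m ⊕ Fin n) :
    Continuous fun X : Fin m → EuclideanSpace ℝ (Fin n) => minor X k z a b :=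
  (continuous_resolvent hz a b).comp (continuous_id.update k continuous_const)

theorem minor_update (X : Fin m → EuclideanSpace ℝ (Fin n)) (k : Fin m)
    (y : EuclideanSpace ℝ (Fin n)) : minor (Function.update X k y) k z = minor X k z := by
  simp [minor]

theorem continuous_col (k : Fin m) (i : Fin n) :
    Continuous fun X : Fin m → EuclideanSpace ℝ (Fin n) => col X k i := by
  unfold col; fun_prop

theorem continuous_minorVec (hz : z.im ≠ 0) (k : Fin m) (i : Fin n) :
    Continuous fun X : Fin m → EuclideanSpace ℝ (Fin n) => minorVec X k z i := by
  unfold minorVec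
  exact continuous_finsetSum _ fun j _ => (continuous_minor hz k _ _).mul (continuous_col k j)

theorem continuous_minorForm (hz : z.im ≠ 0) (k : Fin m) :
    Continuous fun X : Fin m → EuclideanSpace ℝ (Fin n) => minorForm X k z := by
  unfold minorForm
  exact continuous_finsetSum _ fun i _ => (continuous_col k i).mul (continuous_minorVec hz k i)

theorem continuous_ntr (hz : z.im ≠ 0) :
    Continuous fun X : Fin m → EuclideanSpace ℝ (Fin n) => ntr X z := by
  unfold ntr
  exact (continuous_finsetSum _ fun i _ => continuous_resolvent hz _ _).div_const _

/-- Permutation of the coordinates of all the columns. -/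
def permRows (σ : Equiv.Perm (Fin n)) (X : Fin m → EuclideanSpace ℝ (Fin n)) :
    Fin m → EuclideanSpace ℝ (Fin n) := fun j => WithLp.toLp 2 fun i => X j (σ i)

theorem resolvent_permRows (σ : Equiv.Perm (Fin n)) (X : Fin m → EuclideanSpace ℝ (Fin n))
    (i j : Fin n) : resolvent (permRows σ X) z (Sum.inr i) (Sum.inr j) =
      resolvent X z (Sum.inr (σ i)) (Sum.inr (σ j)) := by
  have h : shifted (permRows σ X) z = (shifted X z).submatrix
      (Equiv.sumCongr (Equiv.refl (Fin m)) σ) (Equiv.sumCongr (Equiv.refl (Fin m)) σ) := by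
    ext a b
    rcases a with a | a <;> rcases b with b | b <;>
      simp [shifted_inl_inl, shifted_inl_inr, shifted_inr_inl, shifted_inr_inr, col, permRows]
  rw [resolvent_eq, h, Matrix.inv_submatrix_equiv]
  rfl

theorem minor_permRows (σ : Equiv.Perm (Fin n)) (X : Fin m → EuclideanSpace ℝ (Fin n))
    (k : Fin m) (i j : Fin n) : minor (permRows σ X) k z (Sum.inr i) (Sum.inr j) =
      minor X k z (Sum.inr (σ i)) (Sum.inr (σ j)) := by
  have : Function.update (permRows σ X) k 0 = permRows σ (Function.update X k 0) := by
    funext l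
    rcases eq_or_ne l k with rfl | h
    · ext i; simp [permRows]
    · simp [permRows, h]
  rw [minor, this, resolvent_permRows, ← minor]

variable {γ : Measure (EuclideanSpace ℝ (Fin n))} {μ K₀ : ℝ}

theorem measurePreserving_permRows (h : IsotropicExch γ μ K₀) (σ : Equiv.Perm (Fin n)) :
    MeasurePreserving (permRows (m := m) σ) (Measure.pi fun _ => γ) (Measure.pi fun _ => γ) := by
  have := h.prob
  exact measurePreserving_pi (fun _ => γ) (fun _ => γ) fun _ =>
    ⟨(by fun_prop : Continuous fun x : EuclideanSpace ℝ (Fin n) =>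
      (WithLp.toLp 2 fun i => x (σ i) : EuclideanSpace ℝ (Fin n))).measurable, h.exchangeable σ⟩

/-- An average over the coordinates may replace a single coordinate under the expectation. -/
theorem integral_eq_integral_average {F : Type*} [NormedAddCommGroup F] [NormedSpace ℝ F]
    (h : IsotropicExch γ μ K₀)
    {f : Fin n → (Fin m → EuclideanSpace ℝ (Fin n)) → F}
    (hf : ∀ i, Integrable (f i) (Measure.pi fun _ => γ)) (hc : ∀ i, Continuous (f i))
    (hp : ∀ σ X i, f i (permRows σ X) = f (σ i) X) (i : Fin n) :
    (n : ℝ) • ∫ X, f i X ∂(Measure.pi fun _ => γ) =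
      ∫ X, ∑ j, f j X ∂(Measure.pi fun _ => γ) := by
  rw [integral_finsetSum _ fun j _ => hf j]
  have : ∀ j, ∫ X, f j X ∂(Measure.pi fun _ => γ) = ∫ X, f i X ∂(Measure.pi fun _ => γ) := by
    intro j
    have hmp := measurePreserving_permRows (m := m) h (Equiv.swap i j)
    conv_rhs => rw [← hmp.map_eq]
    rw [integral_map hmp.measurable.aemeasurable]
    · exact integral_congr_ae (ae_of_all _ fun X => by simp [hp])
    · rw [hmp.map_eq]
      have : SecondCountableTopologyEither (Fin m → EuclideanSpace ℝ (Fin n)) F := inferInstance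
      exact (hc i).aestronglyMeasurable
  simp [this, Nat.cast_smul_eq_nsmul]

end

/-! ### Concentration estimates -/

section

variable {n m : ℕ} {z : ℂ}

/-- The sum of the `i`-th row of the lower block of the minor. -/
def minorRowSum (X : Fin m → EuclideanSpace ℝ (Fin n)) (k : Fin m) (z : ℂ) (i : Fin n) : ℂ :=
  ∑ j, minor X k z (Sum.inr i) (Sum.inr j)

theorem sum_norm_sq_minor_row_le (hz : z.im ≠ 0) (X : Fin m → EuclideanSpace ℝ (Fin n))
    (k : Fin m) (i : Fin n) :
    ∑ j, ‖minor X k z (Sum.inr i) (Sum.inr j)‖ ^ 2 ≤ 1 / z.im ^ 2 := by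
  refine le_trans ?_ (sum_norm_sq_resolvent_le (Function.update X k 0) hz (Sum.inr i))
  rw [Fintype.sum_sum_type]
  refine le_trans (le_of_eq ?_) (le_add_of_nonneg_left (Finset.sum_nonneg fun _ _ => sq_nonneg _))
  exact Finset.sum_congr rfl fun j _ => by rw [minor, resolvent_symm]

theorem sum_norm_sq_minorRowSum_le (hz : z.im ≠ 0) (X : Fin m → EuclideanSpace ℝ (Fin n))
    (k : Fin m) : ∑ i, ‖minorRowSum X k z i‖ ^ 2 ≤ n / z.im ^ 2 := by
  have h := sum_norm_sq_resolvent_mulVec_le (Function.update X k 0) hz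
    (Sum.elim (fun _ => 0) (fun _ => 1))
  rw [Fintype.sum_sum_type, Fintype.sum_sum_type] at h
  simp only [Sum.elim_inl, Sum.elim_inr, norm_zero, norm_one, Finset.sum_const, Finset.card_univ,
    Fintype.card_fin, nsmul_eq_mul, one_pow, mul_one, ne_eq, OfNat.ofNat_ne_zero,
    not_false_eq_true, zero_pow, mul_zero, zero_add] at h
  refine le_trans (le_trans (le_of_eq ?_) (le_add_of_nonneg_left
    (Finset.sum_nonneg fun _ _ => sq_nonneg _))) h
  refine Finset.sum_congr rfl fun i _ => ?_
  rw [minorRowSum, Matrix.mulVec, dotProduct, Fintype.sum_sum_type]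
  simp [minor]

theorem continuous_minorRowSum (hz : z.im ≠ 0) (k : Fin m) (i : Fin n) :
    Continuous fun X : Fin m → EuclideanSpace ℝ (Fin n) => minorRowSum X k z i :=
  continuous_finsetSum _ fun _ _ => continuous_minor hz k _ _

theorem minorRowSum_permRows (σ : Equiv.Perm (Fin n)) (X : Fin m → EuclideanSpace ℝ (Fin n))
    (k : Fin m) (i : Fin n) : minorRowSum (permRows σ X) k z i = minorRowSum X k z (σ i) := by
  simp only [minorRowSum, minor_permRows]
  exact Equiv.sum_comp σ fun j => minor X k z (Sum.inr (σ i)) (Sum.inr j)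

variable {γ : Measure (EuclideanSpace ℝ (Fin n))} {μ K₀ : ℝ}

theorem integral_norm_sq_minorRowSum_le (h : IsotropicExch γ μ K₀) (hn : 0 < n) (hz : z.im ≠ 0)
    (k : Fin m) (i : Fin n) :
    Integrable (fun X => ‖minorRowSum X k z i‖ ^ 2) (Measure.pi fun _ : Fin m => γ) ∧
    ∫ X, ‖minorRowSum X k z i‖ ^ 2 ∂(Measure.pi fun _ : Fin m => γ) ≤ 1 / z.im ^ 2 := by
  have := h.prob
  have hn' : (0 : ℝ) < n := by exact_mod_cast hn
  have hc : ∀ j, Continuous fun X : Fin m → EuclideanSpace ℝ (Fin n) =>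
      ‖minorRowSum X k z j‖ ^ 2 := fun j => (continuous_minorRowSum hz k j).norm.pow 2
  have hi : ∀ j, Integrable (fun X => ‖minorRowSum X k z j‖ ^ 2)
      (Measure.pi fun _ : Fin m => γ) := fun j =>
    integrable_of_abs_le (M := n / z.im ^ 2) (hc j).measurable fun X => by
      rw [abs_of_nonneg (sq_nonneg _)]
      exact (Finset.single_le_sum (f := fun j => ‖minorRowSum X k z j‖ ^ 2)
        (fun _ _ => sq_nonneg _) (Finset.mem_univ j)).trans (sum_norm_sq_minorRowSum_le hz X k)
  refine ⟨hi i, ?_⟩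
  have h1 := integral_eq_integral_average h hi hc
    (fun σ X i => by rw [minorRowSum_permRows]) i
  have h2 : ∫ X, ∑ j, ‖minorRowSum X k z j‖ ^ 2 ∂(Measure.pi fun _ : Fin m => γ) ≤
      n / z.im ^ 2 := by
    have := integral_mono (integrable_finsetSum _ fun j _ => hi j)
      (integrable_const (μ := Measure.pi fun _ : Fin m => γ) ((n : ℝ) / z.im ^ 2))
      fun X => sum_norm_sq_minorRowSum_le hz X k
    simpa using this
  rw [← h1, smul_eq_mul, div_eq_mul_one_div] at h2
  exact le_of_mul_le_mul_left h2 hn'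

end

section

variable {n m : ℕ} {z : ℂ} {γ : Measure (EuclideanSpace ℝ (Fin n))} {μ K₀ K : ℝ}

theorem norm_sq_eq (w : ℂ) : ‖w‖ ^ 2 = w.re ^ 2 + w.im ^ 2 := by
  rw [← Complex.normSq_eq_norm_sq, Complex.normSq_apply]; ring

theorem re_sq_le (w : ℂ) : w.re ^ 2 ≤ ‖w‖ ^ 2 := by rw [norm_sq_eq]; nlinarith [sq_nonneg w.im]

theorem im_sq_le (w : ℂ) : w.im ^ 2 ≤ ‖w‖ ^ 2 := by rw [norm_sq_eq]; nlinarith [sq_nonneg w.re]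

/-- The normalized trace of the minor. -/
def minorTr (X : Fin m → EuclideanSpace ℝ (Fin n)) (k : Fin m) (z : ℂ) : ℂ :=
  (∑ i, minor X k z (Sum.inr i) (Sum.inr i)) / n

/-- The `k`-th column is independent of the minor, so the quadratic form concentrates around its
conditional mean. -/
theorem integral_minorForm_sub_minorTr_le [IsProbabilityMeasure γ] (hF : FormBounds γ K)
    (hn : 0 < n) (hz : z.im ≠ 0) (k : Fin m) :
    Integrable (fun X => ‖minorForm X k z - minorTr X k z‖ ^ 2) (Measure.pi fun _ : Fin m => γ) ∧
    ∫ X, ‖minorForm X k z - minorTr X k z‖ ^ 2 ∂(Measure.pi fun _ : Fin m => γ) ≤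
      2 * K * (1 / z.im ^ 2 / n) := by
  have hn' : (0 : ℝ) < n := by exact_mod_cast hn
  have hct : Continuous fun X : Fin m → EuclideanSpace ℝ (Fin n) => minorTr X k z :=
    (continuous_finsetSum _ fun _ _ => continuous_minor hz k _ _).div_const _
  have main := integral_pi_le_of_update (γ := γ)
    (F := fun X => ‖minorForm X k z - minorTr X k z‖ ^ 2)
    (G := fun _ => 2 * K * (1 / z.im ^ 2 / n))
    (((continuous_minorForm hz k).sub hct).norm.pow 2).measurable (fun _ => sq_nonneg _) k
    (integrable_const _) ?_
  · simpa using main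
  intro X
  set N : Fin n → Fin n → ℂ := fun i j => minor X k z (Sum.inr i) (Sum.inr j) with hN
  have hNs : ∀ i j, N i j = N j i := fun i j => by rw [hN]; exact resolvent_symm _ _ _
  have hrow : ∀ i, ∑ j, ‖N i j‖ ^ 2 ≤ 1 / z.im ^ 2 := sum_norm_sq_minor_row_le hz X k
  have hsum : ∑ i, ‖∑ j, N i j‖ ^ 2 ≤ n / z.im ^ 2 := sum_norm_sq_minorRowSum_le hz X k
  have hβ : (n : ℝ) * (1 / |z.im|) ^ 2 = n / z.im ^ 2 := by
    rw [div_pow, sq_abs, one_pow]; ring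
  have hHS : ∑ i, ∑ j, ‖N i j‖ ^ 2 ≤ n / z.im ^ 2 := by
    refine (Finset.sum_le_sum fun i _ => hrow i).trans (le_of_eq ?_)
    simp; ring
  have q1 := hF.quad (fun i j => (N i j).re) (1 / |z.im|) (fun i j => by rw [hNs])
    (by rw [hβ]; exact (Finset.sum_le_sum fun i _ => Finset.sum_le_sum fun j _ =>
          re_sq_le _).trans hHS)
    (by rw [hβ]; exact (Finset.sum_le_sum fun i _ => by
          rw [← Complex.re_sum]; exact re_sq_le _).trans hsum)
  have q2 := hF.quad (fun i j => (N i j).im) (1 / |z.im|) (fun i j => by rw [hNs])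
    (by rw [hβ]; exact (Finset.sum_le_sum fun i _ => Finset.sum_le_sum fun j _ =>
          im_sq_le _).trans hHS)
    (by rw [hβ]; exact (Finset.sum_le_sum fun i _ => by
          rw [← Complex.im_sum]; exact im_sq_le _).trans hsum)
  rw [hβ] at q1 q2
  have hform : ∀ y : EuclideanSpace ℝ (Fin n),
      minorForm (Function.update X k y) k z - minorTr (Function.update X k y) k z =
        ((1 / n : ℝ) : ℂ) * (∑ i, ∑ j, N i j * ((y i * y j : ℝ) : ℂ) - ∑ i, N i i) := by
    intro y
    have hsq : ((Real.sqrt n : ℝ) : ℂ) ^ 2 = n := by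
      rw [← Complex.ofReal_pow, Real.sq_sqrt hn'.le, Complex.ofReal_natCast]
    have hsn : ((Real.sqrt n : ℝ) : ℂ) ≠ 0 := by
      rw [Complex.ofReal_ne_zero]; positivity
    rw [mul_sub, minorTr, minorForm]
    congr 1
    · rw [Finset.mul_sum]
      refine Finset.sum_congr rfl fun i _ => ?_
      rw [minorVec, Finset.mul_sum, Finset.mul_sum]
      refine Finset.sum_congr rfl fun j _ => ?_
      rw [minor_update]
      simp only [col, Function.update_self, hN]
      push_cast
      rw [← hsq]
      field_simp
    · simp only [minor_update, hN]
      push_cast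
      ring
  have hre : ∀ y : EuclideanSpace ℝ (Fin n),
      (∑ i, ∑ j, N i j * ((y i * y j : ℝ) : ℂ) - ∑ i, N i i).re =
      qform (fun i j => (N i j).re) y - ∑ i, (N i i).re := fun y => by
    simp only [Complex.sub_re, Complex.re_sum, Complex.re_mul_ofReal, qform]
  have him : ∀ y : EuclideanSpace ℝ (Fin n),
      (∑ i, ∑ j, N i j * ((y i * y j : ℝ) : ℂ) - ∑ i, N i i).im =
      qform (fun i j => (N i j).im) y - ∑ i, (N i i).im := fun y => by
    simp only [Complex.sub_im, Complex.im_sum, Complex.im_mul_ofReal, qform]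
  have hF' : ∀ y : EuclideanSpace ℝ (Fin n),
      ‖minorForm (Function.update X k y) k z - minorTr (Function.update X k y) k z‖ ^ 2 =
      (1 / n) ^ 2 * ((qform (fun i j => (N i j).re) y - ∑ i, (N i i).re) ^ 2 +
        (qform (fun i j => (N i j).im) y - ∑ i, (N i i).im) ^ 2) := fun y => by
    rw [hform, norm_mul, mul_pow, norm_sq_eq (_ - _), hre, him, Complex.norm_real,
      Real.norm_eq_abs, sq_abs]
  simp only [hF']
  refine ⟨(q1.1.add q2.1).const_mul _, ?_⟩
  rw [integral_const_mul, integral_add q1.1 q2.1]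
  calc _ ≤ (1 / (n : ℝ)) ^ 2 * (K * (n / z.im ^ 2) + K * (n / z.im ^ 2)) := by
        gcongr
        exacts [q1.2, q2.2]
    _ = _ := by field_simp; ring

/-- The fourth moment of a linear form of the column involves the sum of its coefficients, here a
row sum of the minor, which is small on average by exchangeability of the rows. -/
theorem integral_norm_minorVec_pow_four_le (h : IsotropicExch γ μ K₀) (hF : FormBounds γ K)
    (hK : 0 ≤ K) (hn : 0 < n) (hz : z.im ≠ 0) (k : Fin m) (i : Fin n) :
    Integrable (fun X => ‖minorVec X k z i‖ ^ 4) (Measure.pi fun _ : Fin m => γ) ∧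
    ∫ X, ‖minorVec X k z i‖ ^ 4 ∂(Measure.pi fun _ : Fin m => γ) ≤
      8 * K * (1 / z.im ^ 4 / n ^ 2) := by
  have := h.prob
  have hn' : (0 : ℝ) < n := by exact_mod_cast hn
  obtain ⟨hri, hrle⟩ := integral_norm_sq_minorRowSum_le h hn hz k i
  have hGi : Integrable (fun X => 4 * K / n ^ 2 * (1 / z.im ^ 2) *
      (1 / z.im ^ 2 + ‖minorRowSum X k z i‖ ^ 2)) (Measure.pi fun _ : Fin m => γ) :=
    ((integrable_const _).add hri).const_mul _
  have main := integral_pi_le_of_update (γ := γ) (F := fun X => ‖minorVec X k z i‖ ^ 4)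
    ((continuous_minorVec hz k i).norm.pow 4).measurable (fun _ => by positivity) k hGi ?_
  · refine ⟨main.1, main.2.trans ?_⟩
    rw [integral_const_mul, integral_add (integrable_const _) hri]
    calc _ ≤ 4 * K / n ^ 2 * (1 / z.im ^ 2) * (1 / z.im ^ 2 + 1 / z.im ^ 2) := by
          gcongr
          simp
      _ = _ := by field_simp; ring
  intro X
  set u : Fin n → ℂ := fun j => minor X k z (Sum.inr i) (Sum.inr j) with hu
  have hrow : ∑ j, ‖u j‖ ^ 2 ≤ 1 / z.im ^ 2 := sum_norm_sq_minor_row_le hz X k i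
  have hρ : ∑ j, u j = minorRowSum X k z i := rfl
  have hvec : ∀ y : EuclideanSpace ℝ (Fin n), ‖minorVec (Function.update X k y) k z i‖ ^ 4 =
      1 / n ^ 2 * ((∑ j, (u j).re * y j) ^ 2 + (∑ j, (u j).im * y j) ^ 2) ^ 2 := by
    intro y
    have e1 : minorVec (Function.update X k y) k z i =
        ((1 / Real.sqrt n : ℝ) : ℂ) * ∑ j, u j * (y j : ℂ) := by
      rw [minorVec, Finset.mul_sum]
      refine Finset.sum_congr rfl fun j _ => ?_
      rw [minor_update]
      simp only [col, Function.update_self, hu]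
      push_cast
      ring
    have e2 : (1 / Real.sqrt n) ^ 2 = 1 / (n : ℝ) := by
      rw [div_pow, Real.sq_sqrt hn'.le, one_pow]
    have e3 : ∀ t : ℝ, t ^ 4 = (t ^ 2) ^ 2 := fun t => by ring
    rw [e1, e3, norm_mul, mul_pow, norm_sq_eq (∑ j, _), Complex.norm_real, Real.norm_eq_abs,
      sq_abs, e2, Complex.re_sum, Complex.im_sum, mul_pow, div_pow, one_pow]
    simp only [Complex.re_mul_ofReal, Complex.im_mul_ofReal]
  simp only [hvec]
  obtain ⟨i1, l1⟩ := hF.lin fun j => (u j).re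
  obtain ⟨i2, l2⟩ := hF.lin fun j => (u j).im
  have hle : ∀ y : EuclideanSpace ℝ (Fin n),
      1 / (n : ℝ) ^ 2 * ((∑ j, (u j).re * y j) ^ 2 + (∑ j, (u j).im * y j) ^ 2) ^ 2 ≤
      2 / n ^ 2 * ((∑ j, (u j).re * y j) ^ 4 + (∑ j, (u j).im * y j) ^ 4) := fun y => by
    have e : 2 / (n : ℝ) ^ 2 * ((∑ j, (u j).re * y j) ^ 4 + (∑ j, (u j).im * y j) ^ 4) =
      1 / (n : ℝ) ^ 2 * (2 * ((∑ j, (u j).re * y j) ^ 4 + (∑ j, (u j).im * y j) ^ 4)) := by ring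
    rw [e]
    refine mul_le_mul_of_nonneg_left ?_ (by positivity)
    nlinarith [sq_nonneg ((∑ j, (u j).re * y j) ^ 2 - (∑ j, (u j).im * y j) ^ 2)]
  have ib := (i1.add i2).const_mul (2 / (n : ℝ) ^ 2)
  have ii : Integrable (fun y : EuclideanSpace ℝ (Fin n) =>
      1 / (n : ℝ) ^ 2 * ((∑ j, (u j).re * y j) ^ 2 + (∑ j, (u j).im * y j) ^ 2) ^ 2) γ := by
    refine ib.mono' (by fun_prop : Continuous _).aestronglyMeasurable (ae_of_all _ fun y => ?_)
    rw [Real.norm_of_nonneg (by positivity)]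
    exact hle y
  refine ⟨ii, (integral_mono ii ib hle).trans ?_⟩
  have hib : ∫ y : EuclideanSpace ℝ (Fin n), 2 / (n : ℝ) ^ 2 *
      (((fun y : EuclideanSpace ℝ (Fin n) => (∑ j, (u j).re * y j) ^ 4) +
        fun y : EuclideanSpace ℝ (Fin n) => (∑ j, (u j).im * y j) ^ 4) y) ∂γ =
      2 / (n : ℝ) ^ 2 * (∫ y : EuclideanSpace ℝ (Fin n), (∑ j, (u j).re * y j) ^ 4 ∂γ +
        ∫ y : EuclideanSpace ℝ (Fin n), (∑ j, (u j).im * y j) ^ 4 ∂γ) := by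
    rw [integral_const_mul]
    congr 1
    exact integral_add i1 i2
  refine (le_of_eq hib).trans ?_
  have bd : ∀ a : Fin n → ℝ, (∑ j, a j ^ 2 ≤ ∑ j, ‖u j‖ ^ 2) →
      ((∑ j, a j) ^ 2 ≤ ‖minorRowSum X k z i‖ ^ 2) →
      K * (∑ j, a j ^ 2) * (∑ j, a j ^ 2 + (∑ j, a j) ^ 2) ≤
        K * (1 / z.im ^ 2) * (1 / z.im ^ 2 + ‖minorRowSum X k z i‖ ^ 2) := fun a h1 h2 => by
    have h3 := h1.trans hrow
    gcongr
  have b1 := l1.trans (bd _ (Finset.sum_le_sum fun j _ => re_sq_le _)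
    (by rw [← Complex.re_sum, hρ]; exact re_sq_le _))
  have b2 := l2.trans (bd _ (Finset.sum_le_sum fun j _ => im_sq_le _)
    (by rw [← Complex.im_sum, hρ]; exact im_sq_le _))
  calc _ ≤ 2 / (n : ℝ) ^ 2 * (K * (1 / z.im ^ 2) * (1 / z.im ^ 2 + ‖minorRowSum X k z i‖ ^ 2)
        + K * (1 / z.im ^ 2) * (1 / z.im ^ 2 + ‖minorRowSum X k z i‖ ^ 2)) := by gcongr
    _ = _ := by ring

end

section

variable {n m : ℕ} {z : ℂ} {γ : Measure (EuclideanSpace ℝ (Fin n))} {μ K₀ K c M : ℝ}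

theorem norm_ntr_sub_minorTr_le (hz : z.im ≠ 0) (X : Fin m → EuclideanSpace ℝ (Fin n))
    (k : Fin m) : ‖ntr X z - minorTr X k z‖ ≤ 1 / |z.im| / n := by
  rw [ntr, minorTr, ← sub_div, norm_div, Complex.norm_natCast]
  gcongr
  exact norm_trace_sub_minor_le X hz k

theorem integral_ntr_sub_minorForm_le [IsProbabilityMeasure γ] (hF : FormBounds γ K)
    (hn : 0 < n) (hz : z.im ≠ 0) (k : Fin m) :
    Integrable (fun X => ‖ntr X z - minorForm X k z‖ ^ 2) (Measure.pi fun _ : Fin m => γ) ∧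
    ∫ X, ‖ntr X z - minorForm X k z‖ ^ 2 ∂(Measure.pi fun _ : Fin m => γ) ≤
      (4 * K + 2) * (1 / z.im ^ 2 / n) := by
  have hn1 : (1 : ℝ) ≤ n := by exact_mod_cast hn
  obtain ⟨i1, l1⟩ := integral_minorForm_sub_minorTr_le (m := m) hF hn hz k
  have hle : ∀ X : Fin m → EuclideanSpace ℝ (Fin n), ‖ntr X z - minorForm X k z‖ ^ 2 ≤
      2 * ‖minorForm X k z - minorTr X k z‖ ^ 2 + 2 * (1 / z.im ^ 2 / n) := fun X => by
    have h1 : ‖ntr X z - minorForm X k z‖ ≤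
        ‖ntr X z - minorTr X k z‖ + ‖minorForm X k z - minorTr X k z‖ := by
      have : ntr X z - minorForm X k z =
        (ntr X z - minorTr X k z) - (minorForm X k z - minorTr X k z) := by ring
      rw [this]; exact norm_sub_le _ _
    have h2 : ‖ntr X z - minorTr X k z‖ ^ 2 ≤ 1 / z.im ^ 2 / n := by
      refine (pow_le_pow_left₀ (norm_nonneg _) (norm_ntr_sub_minorTr_le hz X k) 2).trans ?_
      rw [div_pow, div_pow, sq_abs, one_pow]
      exact div_le_div_of_nonneg_left (by positivity) (by positivity) (by nlinarith)
    have h3 := pow_le_pow_left₀ (norm_nonneg _) h1 2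
    nlinarith [sq_nonneg (‖ntr X z - minorTr X k z‖ - ‖minorForm X k z - minorTr X k z‖)]
  have ib : Integrable (fun X => 2 * ‖minorForm X k z - minorTr X k z‖ ^ 2 + 2 * (1 / z.im ^ 2 / n))
      (Measure.pi fun _ : Fin m => γ) := (i1.const_mul 2).add (integrable_const _)
  have ii : Integrable (fun X => ‖ntr X z - minorForm X k z‖ ^ 2)
      (Measure.pi fun _ : Fin m => γ) :=
    ib.mono' (((continuous_ntr hz).sub (continuous_minorForm hz k)).norm.pow
      2).measurable.aestronglyMeasurable (ae_of_all _ fun X => by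
        rw [Real.norm_of_nonneg (sq_nonneg _)]; exact hle X)
  refine ⟨ii, (integral_mono ii ib hle).trans ?_⟩
  rw [integral_add (i1.const_mul 2) (integrable_const _), integral_const_mul]
  simp only [integral_const, probReal_univ, one_smul]
  linarith

/-- Concentration of the normalized trace around `s1`. -/
theorem integral_ntr_sub_s1_le [IsProbabilityMeasure γ] (hF : FormBounds γ K) (hK : 0 ≤ K)
    (hn : 0 < n) (hz : z.im ≠ 0) (hc : 1 ≤ c) (hM : |c * n - m| ≤ M) :
    Integrable (fun X => ‖ntr X z - s1 c z‖ ^ 2) (Measure.pi fun _ : Fin m => γ) ∧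
    ∫ X, ‖ntr X z - s1 c z‖ ^ 2 ∂(Measure.pi fun _ : Fin m => γ) ≤
      (2 * (c + M) ^ 2 * (4 * K + 2) + 2 * M ^ 2) * (1 / z.im ^ 6 / n) := by
  have hn1 : (1 : ℝ) ≤ n := by exact_mod_cast hn
  have hn0 : (0 : ℝ) < n := by linarith
  have hv : 0 < |z.im| := abs_pos.2 hz
  have hM0 : 0 ≤ M := (abs_nonneg _).trans hM
  have hmn : (m : ℝ) / n ≤ c + M := by
    rw [div_le_iff₀ hn0]
    nlinarith [(abs_le.1 hM).1]
  have hcn : |(m : ℝ) / n - c| ≤ M / n := by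
    have : (m : ℝ) / n - c = -(c * n - m) / n := by field_simp; ring
    rw [this, abs_div, abs_neg, abs_of_pos hn0]
    gcongr
  have v6 : |z.im| ^ 6 = z.im ^ 6 := by rw [← abs_pow]; exact abs_of_nonneg (by positivity)
  have v4 : |z.im| ^ 4 = z.im ^ 4 := by rw [← abs_pow]; exact abs_of_nonneg (by positivity)
  have hle : ∀ X : Fin m → EuclideanSpace ℝ (Fin n), ‖ntr X z - s1 c z‖ ^ 2 ≤
      2 * (m / n ^ 2) / z.im ^ 4 * ∑ k, ‖ntr X z - minorForm X k z‖ ^ 2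
        + 2 * M ^ 2 * (1 / z.im ^ 6 / n) := fun X => by
    have h1 := pow_le_pow_left₀ (norm_nonneg _) (norm_ntr_sub_s1_le X hc hn.ne' hz) 2
    set a := (∑ k, ‖ntr X z - minorForm X k z‖) / n / |z.im| ^ 2 with ha
    set b := |(m : ℝ) / n - c| / |z.im| ^ 3 with hb
    have h2 : a ^ 2 ≤ m / n ^ 2 / z.im ^ 4 * ∑ k, ‖ntr X z - minorForm X k z‖ ^ 2 := by
      have cs := sq_sum_le_card_mul_sum_sq (s := Finset.univ)
        (f := fun k => ‖ntr X z - minorForm X k z‖)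
      rw [Finset.card_univ, Fintype.card_fin] at cs
      rw [ha, div_pow, div_pow, ← pow_mul, v4, div_div]
      calc _ ≤ (m * ∑ k, ‖ntr X z - minorForm X k z‖ ^ 2) / (n ^ 2 * z.im ^ 4) := by gcongr
        _ = _ := by field_simp
    have h3 : b ^ 2 ≤ M ^ 2 * (1 / z.im ^ 6 / n) := by
      rw [hb, div_pow, ← pow_mul, v6]
      calc |(m : ℝ) / n - c| ^ 2 / z.im ^ 6 ≤ (M / n) ^ 2 / z.im ^ 6 := by gcongr
        _ = M ^ 2 * (1 / z.im ^ 6 / n ^ 2) := by field_simp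
        _ ≤ _ := by
          gcongr
          nlinarith
    have h4 : (a + b) ^ 2 ≤ 2 * a ^ 2 + 2 * b ^ 2 := by nlinarith [sq_nonneg (a - b)]
    have e : 2 * ((m : ℝ) / n ^ 2) / z.im ^ 4 * ∑ k, ‖ntr X z - minorForm X k z‖ ^ 2 =
      2 * (m / n ^ 2 / z.im ^ 4 * ∑ k, ‖ntr X z - minorForm X k z‖ ^ 2) := by ring
    rw [e]
    linarith
  have hq := fun k : Fin m => integral_ntr_sub_minorForm_le hF hn hz k
  have is : Integrable (fun X => ∑ k, ‖ntr X z - minorForm X k z‖ ^ 2)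
    (Measure.pi fun _ : Fin m => γ) := integrable_finsetSum _ fun k _ => (hq k).1
  have ib : Integrable (fun X => 2 * (m / n ^ 2) / z.im ^ 4 *
      ∑ k, ‖ntr X z - minorForm X k z‖ ^ 2 + 2 * M ^ 2 * (1 / z.im ^ 6 / n))
      (Measure.pi fun _ : Fin m => γ) := (is.const_mul _).add (integrable_const _)
  have ii : Integrable (fun X => ‖ntr X z - s1 c z‖ ^ 2) (Measure.pi fun _ : Fin m => γ) :=
    ib.mono' (((continuous_ntr hz).sub continuous_const).norm.pow
      2).measurable.aestronglyMeasurable (ae_of_all _ fun X => by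
        rw [Real.norm_of_nonneg (sq_nonneg _)]; exact hle X)
  refine ⟨ii, (integral_mono ii ib hle).trans ?_⟩
  rw [integral_add (is.const_mul _) (integrable_const _), integral_const_mul,
    integral_finsetSum _ fun k _ => (hq k).1]
  simp only [integral_const, probReal_univ, one_smul]
  have hs : ∑ k : Fin m, ∫ X, ‖ntr X z - minorForm X k z‖ ^ 2 ∂(Measure.pi fun _ : Fin m => γ) ≤
      m * ((4 * K + 2) * (1 / z.im ^ 2 / n)) := by
    refine (Finset.sum_le_sum fun k _ => (hq k).2).trans (le_of_eq ?_)
    simp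
  calc _ ≤ 2 * (m / n ^ 2) / z.im ^ 4 * (m * ((4 * K + 2) * (1 / z.im ^ 2 / n)))
        + 2 * M ^ 2 * (1 / z.im ^ 6 / n) := by gcongr
    _ = (2 * ((m : ℝ) / n) ^ 2 * (4 * K + 2) + 2 * M ^ 2) * (1 / z.im ^ 6 / n) := by field_simp
    _ ≤ _ := by gcongr

/-- The diagonal entries in the block of the columns. -/
theorem integral_resolvent_inl_sub_s2_le [IsProbabilityMeasure γ] (hF : FormBounds γ K)
    (hK : 0 ≤ K) (hn : 0 < n) (hz : z.im ≠ 0) (hc : 1 ≤ c) (hM : |c * n - m| ≤ M) (k : Fin m) :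
    ∫ X, ‖resolvent X z (Sum.inl k) (Sum.inl k) - s2 c z‖ ^ 2 ∂(Measure.pi fun _ : Fin m => γ) ≤
      2 * ((4 * K + 2) * (1 / z.im ^ 6 / n)
        + (2 * (c + M) ^ 2 * (4 * K + 2) + 2 * M ^ 2) * (1 / z.im ^ 10 / n)) := by
  obtain ⟨i1, l1⟩ := integral_ntr_sub_minorForm_le hF hn hz k
  obtain ⟨i2, l2⟩ := integral_ntr_sub_s1_le (m := m) hF hK hn hz hc hM
  have v4 : |z.im| ^ 4 = z.im ^ 4 := by rw [← abs_pow]; exact abs_of_nonneg (by positivity)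
  have hle : ∀ X : Fin m → EuclideanSpace ℝ (Fin n),
      ‖resolvent X z (Sum.inl k) (Sum.inl k) - s2 c z‖ ^ 2 ≤
      2 / z.im ^ 4 * (‖ntr X z - minorForm X k z‖ ^ 2 + ‖ntr X z - s1 c z‖ ^ 2) := fun X => by
    have h1 := pow_le_pow_left₀ (norm_nonneg _) (norm_resolvent_inl_sub_s2_le X hc hz k) 2
    rw [div_pow, ← pow_mul, v4] at h1
    refine h1.trans ?_
    rw [div_mul_eq_mul_div]
    gcongr
    nlinarith [sq_nonneg (‖ntr X z - minorForm X k z‖ - ‖ntr X z - s1 c z‖)]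
  refine (integral_mono_of_nonneg (ae_of_all _ fun _ => sq_nonneg _)
    ((i1.add i2).const_mul _) (ae_of_all _ hle)).trans ?_
  rw [integral_const_mul, integral_add' i1 i2]
  calc _ ≤ 2 / z.im ^ 4 * ((4 * K + 2) * (1 / z.im ^ 2 / n)
        + (2 * (c + M) ^ 2 * (4 * K + 2) + 2 * M ^ 2) * (1 / z.im ^ 6 / n)) := by gcongr
    _ = _ := by field_simp

/-- The diagonal entries in the block of the rows fluctuate little: removing the `k`-th column
changes the entry by `S_kk (S^{(k)} y_k)_i²`, and the Efron–Stein inequality applies. -/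
theorem exists_integral_resolvent_inr_sub_const_le (h : IsotropicExch γ μ K₀)
    (hF : FormBounds γ K) (hK : 0 ≤ K) (hn : 0 < n) (hz : z.im ≠ 0) (hM : |c * n - m| ≤ M)
    (i : Fin n) : ∃ b : ℂ,
    ∫ X, ‖resolvent X z (Sum.inr i) (Sum.inr i) - b‖ ^ 2 ∂(Measure.pi fun _ : Fin m => γ) ≤
      8 * K * (c + M) * (1 / z.im ^ 6 / n) := by
  have := h.prob
  have hn1 : (1 : ℝ) ≤ n := by exact_mod_cast hn
  have hn0 : (0 : ℝ) < n := by linarith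
  have hM0 : 0 ≤ M := (abs_nonneg _).trans hM
  have hmn : (m : ℝ) ≤ (c + M) * n := by nlinarith [(abs_le.1 hM).1]
  obtain ⟨b, hb⟩ := efron_stein_complex (γ := γ) (M := 1 / |z.im|)
    (f := fun X : Fin m → EuclideanSpace ℝ (Fin n) => resolvent X z (Sum.inr i) (Sum.inr i))
    (g := fun k X => minor X k z (Sum.inr i) (Sum.inr i))
    (continuous_resolvent hz _ _).measurable (fun k => (continuous_minor hz k _ _).measurable)
    (fun X => norm_resolvent_diag_le X hz _) (fun k X => norm_resolvent_diag_le _ hz _)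
    (fun k X y => by simp only [minor_update])
  refine ⟨b, hb.trans ?_⟩
  have hk : ∀ k : Fin m, ∫ X, ‖resolvent X z (Sum.inr i) (Sum.inr i)
      - minor X k z (Sum.inr i) (Sum.inr i)‖ ^ 2 ∂(Measure.pi fun _ : Fin m => γ) ≤
      1 / z.im ^ 2 * (8 * K * (1 / z.im ^ 4 / n ^ 2)) := fun k => by
    obtain ⟨i1, l1⟩ := integral_norm_minorVec_pow_four_le h hF hK hn hz k i
    have hle : ∀ X : Fin m → EuclideanSpace ℝ (Fin n), ‖resolvent X z (Sum.inr i) (Sum.inr i)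
        - minor X k z (Sum.inr i) (Sum.inr i)‖ ^ 2 ≤ 1 / z.im ^ 2 * ‖minorVec X k z i‖ ^ 4 :=
      fun X => by
        rw [resolvent_inr_inr X hz k, add_sub_cancel_left, norm_mul, norm_mul, mul_pow,
          ← pow_two, ← pow_mul]
        refine mul_le_mul_of_nonneg_right ?_ (by positivity)
        refine (pow_le_pow_left₀ (norm_nonneg _) (norm_resolvent_diag_le X hz _) 2).trans ?_
        rw [div_pow, sq_abs, one_pow]
    refine (integral_mono_of_nonneg (ae_of_all _ fun _ => sq_nonneg _) (i1.const_mul _)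
      (ae_of_all _ hle)).trans ?_
    rw [integral_const_mul]
    gcongr
  refine (Finset.sum_le_sum fun k _ => hk k).trans ?_
  simp only [Finset.sum_const, Finset.card_univ, Fintype.card_fin, nsmul_eq_mul]
  calc _ ≤ (c + M) * n * (1 / z.im ^ 2 * (8 * K * (1 / z.im ^ 4 / n ^ 2))) := by gcongr
    _ = _ := by field_simp

/-- The diagonal entries in the block of the rows: by exchangeability of the rows their mean is that
of the normalized trace. -/
theorem integral_resolvent_inr_sub_s1_le (h : IsotropicExch γ μ K₀)
    (hF : FormBounds γ K) (hK : 0 ≤ K) (hn : 0 < n) (hz : z.im ≠ 0) (hc : 1 ≤ c)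
    (hM : |c * n - m| ≤ M) (i : Fin n) :
    ∫ X, ‖resolvent X z (Sum.inr i) (Sum.inr i) - s1 c z‖ ^ 2 ∂(Measure.pi fun _ : Fin m => γ) ≤
      (48 * K * (c + M) + 4 * (2 * (c + M) ^ 2 * (4 * K + 2) + 2 * M ^ 2))
        * (1 / z.im ^ 6 / n) := by
  have := h.prob
  have hn0 : (0 : ℝ) < n := by exact_mod_cast hn
  have hn0' : (n : ℂ) ≠ 0 := by exact_mod_cast hn.ne'
  set π : Measure (Fin m → EuclideanSpace ℝ (Fin n)) := Measure.pi fun _ : Fin m => γ with hπ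
  obtain ⟨b, hb⟩ := exists_integral_resolvent_inr_sub_const_le h hF hK hn hz hM i
  obtain ⟨i2, l2⟩ := integral_ntr_sub_s1_le (m := m) hF hK hn hz hc hM
  rw [← hπ] at hb i2 l2
  set B := 8 * K * (c + M) * (1 / z.im ^ 6 / n) with hB
  set D := (2 * (c + M) ^ 2 * (4 * K + 2) + 2 * M ^ 2) * (1 / z.im ^ 6 / n) with hD
  have iS : ∀ j : Fin n, Integrable (fun X => resolvent X z (Sum.inr j) (Sum.inr j)) π := fun j =>
    Integrable.of_bound (continuous_resolvent hz _ _).measurable.aestronglyMeasurable (1 / |z.im|)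
      (ae_of_all _ fun X => norm_resolvent_diag_le X hz _)
  have ig : Integrable (fun X => ntr X z) π :=
    Integrable.of_bound (continuous_ntr hz).measurable.aestronglyMeasurable (1 / |z.im|)
      (ae_of_all _ fun X => norm_ntr_le X hz)
  have hmean : ∫ X, resolvent X z (Sum.inr i) (Sum.inr i) ∂π = ∫ X, ntr X z ∂π := by
    have := integral_eq_integral_average h iS (fun j => continuous_resolvent hz _ _)
      (fun σ X j => resolvent_permRows σ X j j) i
    simp only [ntr]
    rw [integral_div, ← this, ← hπ, Complex.real_smul, Complex.ofReal_natCast]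
    field_simp
  have iSb : Integrable (fun X => ‖resolvent X z (Sum.inr i) (Sum.inr i) - b‖ ^ 2) π := by
    refine integrable_of_abs_le (M := (1 / |z.im| + ‖b‖) ^ 2)
      (((continuous_resolvent hz _ _).sub continuous_const).norm.pow 2).measurable fun X => ?_
    rw [abs_of_nonneg (sq_nonneg _)]
    refine pow_le_pow_left₀ (norm_nonneg _) ((norm_sub_le _ _).trans ?_) 2
    gcongr
    exact norm_resolvent_diag_le X hz _
  have ig' : Integrable (fun X => ntr X z - s1 c z) π := ig.sub (integrable_const _)
  have iS' : Integrable (fun X => resolvent X z (Sum.inr i) (Sum.inr i) - b) π :=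
    (iS i).sub (integrable_const _)
  have hbs : ‖b - s1 c z‖ ^ 2 ≤ 2 * B + 2 * D := by
    have e : b - s1 c z = ∫ X, ((ntr X z - s1 c z)
        - (resolvent X z (Sum.inr i) (Sum.inr i) - b)) ∂π := by
      rw [integral_sub ig' iS',
        integral_sub ig (integrable_const _), integral_sub (iS i) (integrable_const _), hmean]
      simp
    have h1 : ‖b - s1 c z‖ ≤ ∫ X, ‖(ntr X z - s1 c z)
        - (resolvent X z (Sum.inr i) (Sum.inr i) - b)‖ ∂π := by
      rw [e]; exact norm_integral_le_integral_norm _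
    set t := ‖b - s1 c z‖ with ht
    -- Jensen's inequality through `2 t x - t² ≤ x²`
    have it : Integrable (fun X => ‖(ntr X z - s1 c z)
        - (resolvent X z (Sum.inr i) (Sum.inr i) - b)‖) π :=
      (ig'.sub iS').norm
    have ir : Integrable (fun X => 2 * ‖ntr X z - s1 c z‖ ^ 2
        + 2 * ‖resolvent X z (Sum.inr i) (Sum.inr i) - b‖ ^ 2) π :=
      (i2.const_mul 2).add (iSb.const_mul 2)
    have h2 := integral_mono ((it.const_mul (2 * t)).sub (integrable_const (t ^ 2))) ir
      fun X => by
        have h3 := norm_sub_le (ntr X z - s1 c z) (resolvent X z (Sum.inr i) (Sum.inr i) - b)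
        have h4 := pow_le_pow_left₀ (norm_nonneg _) h3 2
        simp only [Pi.sub_apply]
        nlinarith [sq_nonneg (‖ntr X z - s1 c z‖ - ‖resolvent X z (Sum.inr i) (Sum.inr i) - b‖),
          sq_nonneg (t - ‖(ntr X z - s1 c z) - (resolvent X z (Sum.inr i) (Sum.inr i) - b)‖)]
    rw [integral_sub' (it.const_mul (2 * t)) (integrable_const (t ^ 2)), integral_const_mul,
      integral_add (i2.const_mul 2) (iSb.const_mul 2), integral_const_mul,
      integral_const_mul] at h2
    simp only [integral_const, probReal_univ, one_smul] at h2
    have h5 := mul_le_mul_of_nonneg_left h1 (norm_nonneg (b - s1 c z))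
    rw [← ht] at h5
    nlinarith
  have hle : ∀ X : Fin m → EuclideanSpace ℝ (Fin n),
      ‖resolvent X z (Sum.inr i) (Sum.inr i) - s1 c z‖ ^ 2 ≤
      2 * ‖resolvent X z (Sum.inr i) (Sum.inr i) - b‖ ^ 2 + 2 * ‖b - s1 c z‖ ^ 2 := fun X => by
    have h3 := norm_sub_le_norm_sub_add_norm_sub (resolvent X z (Sum.inr i) (Sum.inr i)) b (s1 c z)
    have h4 := pow_le_pow_left₀ (norm_nonneg _) h3 2
    nlinarith [sq_nonneg (‖resolvent X z (Sum.inr i) (Sum.inr i) - b‖ - ‖b - s1 c z‖)]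
  refine (integral_mono_of_nonneg (ae_of_all _ fun _ => sq_nonneg _)
    ((iSb.const_mul 2).add (integrable_const _)) (ae_of_all _ hle)).trans ?_
  rw [integral_add' (iSb.const_mul 2) (integrable_const _), integral_const_mul]
  simp only [integral_const, probReal_univ, one_smul]
  have : (48 * K * (c + M) + 4 * (2 * (c + M) ^ 2 * (4 * K + 2) + 2 * M ^ 2))
        * (1 / z.im ^ 6 / n) = 6 * B + 4 * D := by rw [hB, hD]; ring
  rw [this]
  linarith

end

/-! ### Uniform constants -/

theorem Hypo1.isotropicExch {n : ℕ} {V : EuclideanSpace ℝ (Fin n) → ℝ} {C μ K₀ : ℝ}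
    (h : Hypo1 V C μ) (hC : 0 < C)
    (hv : variance (fun x : EuclideanSpace ℝ (Fin n) => ∑ i, x i ^ 2) (gibbs V) ≤ K₀ * n) :
    IsotropicExch (gibbs V) μ K₀ where
  prob := h.isProbabilityMeasure hC
  integrable := h.integrable_norm_pow_four hC
  covariance := h.covariance
  fourth := h.fourth
  exchangeable := h.exchangeable
  variance_le := hv

theorem norm_sub_sq_le_of_le {v : ℝ} {a b : ℂ} (ha : ‖a‖ ≤ 1 / v) (hb : ‖b‖ ≤ 1 / v) :
    ‖a - b‖ ^ 2 ≤ 4 * (1 / v ^ 2) := by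
  have h := (norm_sub_le a b).trans (add_le_add ha hb)
  refine (pow_le_pow_left₀ (norm_nonneg _) h 2).trans (le_of_eq ?_)
  rw [← two_mul, mul_pow, div_pow, one_pow]; norm_num

/-- All powers of `1 / |Im z|` up to the sixteenth are controlled by `v₀⁻¹⁶`, because `v₀ < R`. -/
theorem one_div_im_pow_le {R v₀ : ℝ} {z : ℂ} (hv₀ : 0 < v₀) (hz : z ∈ domain R v₀) {p : ℕ}
    (hp : p ≤ 16) : 1 / |z.im| ^ p ≤ R ^ (16 - p) * v₀ ^ (-16 : ℤ) := by
  obtain ⟨h1, h2⟩ := hz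
  have hR : v₀ ≤ R := (h1.trans (Complex.abs_im_le_norm z)).trans h2.le
  have e : v₀ ^ (-16 : ℤ) = 1 / v₀ ^ 16 := by
    rw [zpow_neg, one_div]; norm_cast
  calc 1 / |z.im| ^ p ≤ 1 / v₀ ^ p := by gcongr
    _ = v₀ ^ (16 - p) * v₀ ^ (-16 : ℤ) := by
      rw [e]
      have : v₀ ^ 16 = v₀ ^ (16 - p) * v₀ ^ p := by rw [← pow_add]; congr 1; omega
      rw [this]
      field_simp
    _ ≤ _ := by gcongr

end LogConcaveCov
end

open LogConcaveCov in
theorem mainTheorem5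
    -- the model: potentials, a potential-independent Hessian bound and fourth moment
    (V : (n : ℕ) → EuclideanSpace ℝ (Fin n) → ℝ) (C μ κ c σ : ℝ) (m : ℕ → ℕ)
    (hC : 0 < C) (h1 : ∀ n, LogConcaveCov.Hypo1 (V n) C μ)
    (hκ : 0 < κ)
    (h2 : Tendsto (fun n : ℕ =>
      (n : ℝ)⁻¹ * variance (fun x : EuclideanSpace ℝ (Fin n) => ∑ i, x i ^ 2) (LogConcaveCov.gibbs (V n)))
      atTop (𝓝 κ))
    (hc : 1 ≤ c)
    (h3 : Tendsto (fun n : ℕ => (m n : ℝ) / n) atTop (𝓝 c))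
    (h3' : Tendsto (fun n : ℕ => c * n - m n) atTop (𝓝 σ))
    -- for each `n`, the `m n` independent copies of the random vector
    {Ω : Type*} [MeasurableSpace Ω] (P : Measure Ω) [IsProbabilityMeasure P]
    (X : (n : ℕ) → Fin (m n) → Ω → EuclideanSpace ℝ (Fin n))
    (hlaw : ∀ n j, HasLaw (X n j) (LogConcaveCov.gibbs (V n)) P)
    (hindep : ∀ n, iIndepFun (X n) P)
    (R : ℝ) (hR : 0 < R) :
    ∃ K : ℝ, 0 < K ∧ ∀ n : ℕ, 1 ≤ n → ∀ v₀ : ℝ, (n : ℝ) ^ (-(1 / 16) : ℝ) ≤ v₀ →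
      ∀ z ∈ LogConcaveCov.domain R v₀,
        (∀ i : Fin (m n),
          Integrable (fun ω =>
            ‖LogConcaveCov.resolvent (fun j => X n j ω) z (Sum.inl i) (Sum.inl i) - LogConcaveCov.s2 c z‖ ^ 2) P ∧
          ∫ ω, ‖LogConcaveCov.resolvent (fun j => X n j ω) z (Sum.inl i) (Sum.inl i) - LogConcaveCov.s2 c z‖ ^ 2 ∂P
            ≤ K * (v₀ ^ (-16 : ℤ) / n)) ∧
        (∀ i : Fin n,
          Integrable (fun ω =>
            ‖LogConcaveCov.resolvent (fun j => X n j ω) z (Sum.inr i) (Sum.inr i) - LogConcaveCov.s1 c z‖ ^ 2) P ∧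
          ∫ ω, ‖LogConcaveCov.resolvent (fun j => X n j ω) z (Sum.inr i) (Sum.inr i) - LogConcaveCov.s1 c z‖ ^ 2 ∂P
            ≤ K * (v₀ ^ (-16 : ℤ) / n)) := by
  -- the convergent sequences in the hypotheses are bounded
  obtain ⟨K₀, hK₀⟩ := h2.bddAbove_range
  obtain ⟨M, hM⟩ := h3'.abs.bddAbove_range
  replace hM : ∀ n : ℕ, |c * n - m n| ≤ M := fun n => hM ⟨n, rfl⟩
  have hM0 : 0 ≤ M := (abs_nonneg _).trans (hM 0)
  obtain ⟨K, hK, hform⟩ := exists_form_bounds μ K₀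
  set K₁ := 2 * (c + M) ^ 2 * (4 * K + 2) + 2 * M ^ 2 with hK₁
  have hK₁0 : 0 < K₁ := by
    have : 0 < c + M := by linarith
    positivity
  have hcM : 0 < c + M := by linarith
  set KS := 16 * R ^ 14 with hKS
  set KI := 2 * ((4 * K + 2) * R ^ 10 + K₁ * R ^ 6) with hKI
  set KR := (48 * K * (c + M) + 4 * K₁) * R ^ 10 with hKR
  have pS : 0 < KS := by positivity
  have pI : 0 < KI := by positivity
  have pR : 0 < KR := by positivity
  refine ⟨KS + KI + KR, by positivity, fun n hn v₀ hv₀ z hz => ?_⟩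
  have hn1 : (1 : ℝ) ≤ n := by exact_mod_cast hn
  have hn0 : (0 : ℝ) < n := by linarith
  have hv₀0 : 0 < v₀ := (Real.rpow_pos_of_pos hn0 _).trans_le hv₀
  have habs : 0 < |z.im| := hv₀0.trans_le hz.1
  have hzim : z.im ≠ 0 := abs_pos.1 habs
  have hexch : IsotropicExch (gibbs (V n)) μ K₀ := by
    refine (h1 n).isotropicExch hC ?_
    have : (n : ℝ)⁻¹ * variance (fun x : EuclideanSpace ℝ (Fin n) => ∑ i, x i ^ 2)
      (gibbs (V n)) ≤ K₀ := hK₀ ⟨n, rfl⟩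
    rwa [inv_mul_eq_div, div_le_iff₀ hn0] at this
  have hprob := hexch.prob
  have hjoint : HasLaw (fun ω j => X n j ω) (Measure.pi fun _ => gibbs (V n)) P :=
    (iIndepFun_iff_hasLaw_pi_pi (hlaw n)).1 (hindep n)
  -- the trivial bound gives integrability, and the estimate for the first few `n`
  have htriv : ∀ (a : Fin (m n) ⊕ Fin n) (s : ℂ), ‖s‖ ≤ 1 / |z.im| → ∀ Y,
      ‖resolvent Y z a a - s‖ ^ 2 ≤ 4 * (1 / |z.im| ^ 2) := fun a s hs Y =>
    norm_sub_sq_le_of_le (norm_resolvent_diag_le Y hzim a) hs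
  have hcont : ∀ (a : Fin (m n) ⊕ Fin n) (s : ℂ),
      Continuous fun Y => ‖resolvent Y z a a - s‖ ^ 2 := fun a s =>
    ((continuous_resolvent hzim a a).sub continuous_const).norm.pow 2
  have hpos : 0 < v₀ ^ (-16 : ℤ) / n := by positivity
  have key : ∀ (a : Fin (m n) ⊕ Fin n) (s : ℂ) (A : ℝ), ‖s‖ ≤ 1 / |z.im| →
      A ≤ KS + KI + KR → KS ≤ KS + KI + KR →
      (4 ≤ n → ∫ Y, ‖resolvent Y z a a - s‖ ^ 2 ∂(Measure.pi fun _ => gibbs (V n)) ≤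
        A * (v₀ ^ (-16 : ℤ) / n)) →
      Integrable (fun ω => ‖resolvent (fun j => X n j ω) z a a - s‖ ^ 2) P ∧
      ∫ ω, ‖resolvent (fun j => X n j ω) z a a - s‖ ^ 2 ∂P ≤
        (KS + KI + KR) * (v₀ ^ (-16 : ℤ) / n) := by
    intro a s A hs hA hS hbig
    have hint : Integrable (fun ω => ‖resolvent (fun j => X n j ω) z a a - s‖ ^ 2) P :=
      Integrable.of_bound ((hcont a s).measurable.comp_aemeasurable
        hjoint.aemeasurable).aestronglyMeasurable (4 * (1 / |z.im| ^ 2))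
        (ae_of_all _ fun ω => by
          rw [Real.norm_of_nonneg (sq_nonneg _)]
          exact htriv a s hs _)
    refine ⟨hint, ?_⟩
    rcases le_or_gt 4 n with h4 | h4
    · have e : ∫ ω, ‖resolvent (fun j => X n j ω) z a a - s‖ ^ 2 ∂P =
          ∫ Y, ‖resolvent Y z a a - s‖ ^ 2 ∂(Measure.pi fun _ => gibbs (V n)) := by
        rw [← hjoint.map_eq, integral_map hjoint.aemeasurable
          (hcont a s).measurable.aestronglyMeasurable]
      rw [e]
      exact (hbig h4).trans (mul_le_mul_of_nonneg_right hA hpos.le)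
    · have h5 : ∫ ω, ‖resolvent (fun j => X n j ω) z a a - s‖ ^ 2 ∂P ≤ 4 * (1 / |z.im| ^ 2) := by
        have := integral_mono hint (integrable_const (4 * (1 / |z.im| ^ 2)))
          fun ω => htriv a s hs _
        simpa using this
      have hn4 : (n : ℝ) ≤ 4 := by exact_mod_cast h4.le
      have h6 := one_div_im_pow_le hv₀0 hz (p := 2) (by norm_num)
      calc _ ≤ 4 * (1 / |z.im| ^ 2) := h5
        _ ≤ 4 * (R ^ 14 * v₀ ^ (-16 : ℤ)) := by gcongr
        _ = KS * (v₀ ^ (-16 : ℤ) / 4) := by rw [hKS]; ring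
        _ ≤ KS * (v₀ ^ (-16 : ℤ) / n) := by gcongr
        _ ≤ _ := mul_le_mul_of_nonneg_right hS hpos.le
  have hF : 4 ≤ n → FormBounds (gibbs (V n)) K := fun h4 => hform n h4 _ hexch
  have b6 : 1 / z.im ^ 6 ≤ R ^ 10 * v₀ ^ (-16 : ℤ) := by
    have := one_div_im_pow_le hv₀0 hz (p := 6) (by norm_num)
    rwa [Even.pow_abs (by decide)] at this
  have b10 : 1 / z.im ^ 10 ≤ R ^ 6 * v₀ ^ (-16 : ℤ) := by
    have := one_div_im_pow_le hv₀0 hz (p := 10) (by norm_num)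
    rwa [Even.pow_abs (by decide)] at this
  refine ⟨fun i => key _ _ KI (norm_s2_le hc hzim) (by linarith) (by linarith) fun h4 => ?_,
    fun i => key _ _ KR (norm_s1_le hc hzim) (by linarith) (by linarith) fun h4 => ?_⟩
  · refine (integral_resolvent_inl_sub_s2_le (hF h4) hK.le hn hzim hc (hM n) i).trans ?_
    rw [← hK₁]
    calc _ ≤ 2 * ((4 * K + 2) * (R ^ 10 * v₀ ^ (-16 : ℤ) / n)
          + K₁ * (R ^ 6 * v₀ ^ (-16 : ℤ) / n)) := by gcongr
      _ = _ := by rw [hKI]; ring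
  · refine (integral_resolvent_inr_sub_s1_le hexch (hF h4) hK.le hn hzim hc (hM n) i).trans ?_
    rw [← hK₁]
    calc _ ≤ (48 * K * (c + M) + 4 * K₁) * (R ^ 10 * v₀ ^ (-16 : ℤ) / n) := by gcongr
      _ = _ := by rw [hKR]; ring
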